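/- Words over a set $\Sigma$ are finite lists of elements of $\Sigma$. A word is \emph{primitive} if it is nonempty and not a power of a shorter word, and \emph{imprimitive} otherwise; two words $u,v$ are \emph{conjugate} if $u=rq$ and $v=qr$ for some words $r,q$. A set $B$ of words is a \emph{code} if every word has at most one factorization into elements of $B$. A list $\mathbf w$ over $B$ is itself a word whose letters are elements of $B$; its concatenation is a word over $\Sigma$. The set $B$ is \emph{primitivity preserving} if there is no primitive list $\mathbf w$ over $B$ with $|\mathbf w|\ge 2$ whose concatenation is imprimitive. Theorem. Let $x,y$ be words over $\Sigma$ such that $B=\{x,y\}$ is a code that is not primitivity preserving. Then there are integers $j,k\ge 1$, with $j=1$ or $k=1$, such that for every list $\mathbf w$ over $B$ with $|\mathbf w|\ge 2$ the following are equivalent: (i) $\mathbf w$ is primitive and its concatenation is imprimitive; (ii) $\mathbf w$ is conjugate with $[x]^j[y]^k$ (the list consisting of $j$ copies of $x$ followed by $k$ copies of $y$). The pair $(j,k)$ is the only pair of integers $\ge 1$ for which (i) and (ii) are equivalent for all such $\mathbf w$. Moreover, if $|y|\le|x|$, then: if $j\ge 2$, then $j=2$, $k=1$, and both $x$ and $y$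 are primitive; and if $k\ge 2$, then $j=1$ and $x$ is primitive. -/

import Mathlib

/-! Words over `α` are finite lists of elements of `α`. Lists over a set `X` of words are lists
of type `List (List α)` all of whose entries belong to `X`, and the concatenation of such a list is
`List.flatten`. A set of words is a code if it satisfies `InformationTheory.UniquelyDecodable`, and
two words are conjugate if they satisfy `List.IsRotated`. -/

namespace Words

/-- The power `u ^ n` of a word: the concatenation of `n` copies of `u`. -/
def pow {α : Type*} (u : List α) (n : ℕ) : List α :=
  (List.replicate n u).flatten

/-- A word is primitive if it is nonempty and not a power of a shorter word. -/
def IsPrimitive {α : Type*} (w : List α) : Prop :=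
  w ≠ [] ∧ ¬ ∃ (u : List α) (n : ℕ), u.length < w.length ∧ w = pow u n

/-- The list `w` of words is primitive (as a word whose letters are words), while its
concatenation is imprimitive (as a word over the underlying alphabet). -/
def IsPrimitiveWithImprimitiveConcat {α : Type*} (w : List (List α)) : Prop :=
  IsPrimitive w ∧ ¬ IsPrimitive w.flatten

/-- A set `X` of words is primitivity preserving if no primitive list over `X` of length at least
two has an imprimitive concatenation. -/
def IsPrimitivityPreserving {α : Type*} (X : Set (List α)) : Prop :=
  ¬ ∃ w : List (List α),
    (∀ u ∈ w, u ∈ X) ∧ 2 ≤ w.length ∧ IsPrimitiveWithImprimitiveConcat w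

/-- The lists over `{x, y}` of length at least two that are primitive with an imprimitive
concatenation are exactly the conjugates of `[x]^j [y]^k` (among the lists over `{x, y}` of length
at least two). -/
def WitnessesAreConjugatesOf {α : Type*} (x y : List α) (j k : ℕ) : Prop :=
  ∀ w : List (List α), (∀ u ∈ w, u ∈ ({x, y} : Set (List α))) → 2 ≤ w.length →
    (IsPrimitiveWithImprimitiveConcat w ↔ List.IsRotated w (pow [x] j ++ pow [y] k))

end Words

/-!
The classification of binary codes that do not preserve primitivity rests on one fact
(`isRotated_of_two_le_count`): if `x` and `y` do not commute, `|y| ≤ |x|`, and a primitive list over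
`{x, y}` with at least two letters `x` has an imprimitive concatenation, then it is a conjugate of
`xxy`.

Lists over `{x, y}` are described by lists of booleans, and concatenation becomes the substitution
`ev x y`. Suppose that the concatenation of a primitive list is a proper power `z^l`, and repeat it
in both directions. The bi-infinite word so obtained has a factorization into letters `x` and `y`,
and the translate of this factorization by `|z|` is another one. The two have no cut in common
(`cutPos_ne`): a common cut would make the list equal to a proper rotation of itself, because
noncommuting words generate freely.

Let `x` and `y` be primitive and `|y| < |x|`, and let `xx` be a factor of the first factorization.
A primitive word does not occur inside its own square, so the second factorization covers `xx` by
letters `y`, with at most one `x` at either end. The theorem of Fine and Wilf, applied to the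
periods that these overlaps create, leaves only `xyx`, placed symmetrically around `xx` and followed
by `x` (`square_cover`). Exchanging the roles of the two factorizations, `xx` continues as `xxyxx`
(`square_next`), so the list is a conjugate of `xxy`. If `|x| = |y|`, then the translates by all
multiples of `|z|` put a letter at every position in a residue class modulo `gcd(|z|, |x|)`, which
is impossible (`equal_length_no_square`).

Arbitrary `x` and `y` are powers of primitive words, and replacing letters by powers of letters
preserves primitivity of lists; if the root of `y` is longer than the root of `x`, then `xx` is at
least a fourth power, which is too long to be covered (`power_cover`). If the list has no factor
`xx` even cyclically, then it is a list over `{xy, y}`, and one argues by induction on its length,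
since `xyxyy` is primitive.

The theorem of Lyndon and Schützenberger (`isPrimitive_pow_append_pow`) is a consequence. The
remaining possibilities are `xxy` and `x y^k`; that at most one of these words is imprimitive
follows, when `x y^k` and `x y^k'` with `k + 2 ≤ k'` are compared, from this theorem, and otherwise
by exhibiting, in the repetition of one of the words, a window with a short second period, which is
then a period of the whole repetition and forces `x` and `y` to commute.
-/

namespace Words

/-! ### Local periods of functions on the integers -/

section

variable {β : Type*} {f X Y : ℤ → β}

/-- `f` has period `p` on the integer interval `[a, b)`. -/
def Per (f : ℤ → β) (p a b : ℤ) : Prop := ∀ t, a ≤ t → t + p < b → f t = f (t + p)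

/-- The word `X 0, …, X (n - 1)` occurs in `f` at position `c`. -/
def Occ (f X : ℤ → β) (n c : ℤ) : Prop := ∀ t, 0 ≤ t → t < n → f (c + t) = X t

/-- The word `X 0, …, X (n - 1)` is not a proper power, stated in terms of its periods. -/
def PrimWord (X : ℤ → β) (n : ℤ) : Prop := ∀ d, 0 < d → d ∣ n → Per X d 0 n → d = n

/-- The function on `ℤ` that repeats the first `p` values of `f` from position `a` on
periodically in both directions. -/
def unroll (f : ℤ → β) (a p : ℤ) : ℤ → β := fun t => f (a + (t - a) % p)

lemma Per.mono {p a b a' b' : ℤ} (h : Per f p a b) (ha : a ≤ a') (hb : b' ≤ b) :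
    Per f p a' b' := fun t h1 h2 => h t (by omega) (by omega)

lemma Per.natMul {p a b : ℤ} (h : Per f p a b) (hp : 0 ≤ p) (k : ℕ) : Per f (k * p) a b := by
  induction k with
  | zero => intro t _ _; simp
  | succ k ih =>
    intro t h1 h2
    have h0 : 0 ≤ (k : ℤ) * p := by positivity
    have e : t + ((k + 1 : ℕ) : ℤ) * p = (t + k * p) + p := by push_cast; ring
    rw [e] at h2 ⊢
    rw [ih t h1 (by omega), h (t + k * p) (by omega) h2]

lemma Per.of_dvd {p q a b : ℤ} (h : Per f p a b) (hp : 0 < p) (hq : 0 ≤ q) (hd : p ∣ q) :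
    Per f q a b := by
  obtain ⟨k, rfl⟩ := hd
  have hk : 0 ≤ k := by
    by_contra hk
    nlinarith
  obtain ⟨k, rfl⟩ := Int.eq_ofNat_of_zero_le hk
  rw [mul_comm]
  exact h.natMul hp.le k

lemma Per.of_periodic {p : ℤ} (h : Function.Periodic f p) (a b : ℤ) : Per f p a b :=
  fun t _ _ => (h t).symm

lemma unroll_periodic (f : ℤ → β) (a p : ℤ) : Function.Periodic (unroll f a p) p := by
  intro t
  have : (t + p - a) % p = (t - a) % p := by
    rw [show t + p - a = t - a + p by ring]; simp
  simp only [unroll, this]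

lemma unroll_eq {p a b t : ℤ} (h : Per f p a b) (hp : 0 < p) (h1 : a ≤ t) (h2 : t < b) :
    unroll f a p t = f t := by
  have h3 := Int.emod_add_mul_ediv (t - a) p
  have h4 := Int.emod_nonneg (t - a) hp.ne'
  have h5 : 0 ≤ (t - a) / p := Int.ediv_nonneg (by omega) hp.le
  have h6 : 0 ≤ p * ((t - a) / p) := by positivity
  have := h.of_dvd hp h6 ⟨_, rfl⟩ (a + (t - a) % p) (by omega) (by omega)
  rw [unroll, this]
  congr 1
  omega

/-- A period of a long enough window of a periodic function is a period of the function. -/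
lemma periodic_of_window {Z p a b : ℤ} (hf : Function.Periodic f Z) (hZ : 0 < Z)
    (h : Per f p a b) (hl : Z + p ≤ b - a) : Function.Periodic f p := by
  intro t
  have h3 := Int.emod_add_mul_ediv (t - a) Z
  have h4 := Int.emod_nonneg (t - a) hZ.ne'
  have h5 := Int.emod_lt_of_pos (t - a) hZ
  have := h (a + (t - a) % Z) (by omega) (by omega)
  have e1 := hf.int_mul ((t - a) / Z) (a + (t - a) % Z)
  have e2 := hf.int_mul ((t - a) / Z) (a + (t - a) % Z + p)
  have e3 : a + (t - a) % Z + ((t - a) / Z : ℤ) * Z = t := by rw [mul_comm ((t - a) / Z)]; omega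
  have e4 : a + (t - a) % Z + p + ((t - a) / Z : ℤ) * Z = t + p := by
    rw [mul_comm ((t - a) / Z)]; omega
  simp only [Int.cast_id] at e1 e2
  rw [e3] at e1
  rw [e4] at e2
  rw [e1, e2, this]

lemma periodic_of_dvd {p q : ℤ} (hp : Function.Periodic f p) (hd : p ∣ q) :
    Function.Periodic f q := by
  obtain ⟨k, rfl⟩ := hd
  simpa [mul_comm] using hp.int_mul k

lemma periodic_gcd {p q : ℤ} (hp : Function.Periodic f p) (hq : Function.Periodic f q) :
    Function.Periodic f (Int.gcd p q : ℤ) := by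
  rw [Int.gcd_eq_gcd_ab]
  exact (periodic_of_dvd hp ⟨_, rfl⟩).add_period (periodic_of_dvd hq ⟨_, rfl⟩)

/-- A weak form of the theorem of Fine and Wilf. -/
lemma Per.gcd {p q a b : ℤ} (hp : Per f p a b) (hq : Per f q a b) (h0 : 0 < p) (h1 : 0 < q)
    (hl : p + q ≤ b - a) : Per f (Int.gcd p q : ℤ) a b := by
  have hu := unroll_periodic f a p
  have hu' : Function.Periodic (unroll f a p) q := by
    refine periodic_of_window (a := a) (b := b) hu h0 ?_ hl
    intro t ht1 ht2
    rw [unroll_eq hp h0 ht1 (by omega), unroll_eq hp h0 (by omega) ht2]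
    exact hq t ht1 ht2
  intro t ht1 ht2
  have := periodic_gcd hu hu' t
  rw [unroll_eq hp h0 ht1 (by omega), unroll_eq hp h0 (by omega) ht2] at this
  exact this.symm

/-- A period `d` of a window of length `n` extends to the whole range where `f` has period `n`,
if `d ∣ n`. -/
lemma Per.extend {n d a b a' b' : ℤ} (h : Per f n a b) (h' : Per f d a' b') (ha : a ≤ a')
    (hb : b' ≤ b) (hl : n ≤ b' - a') (hd : 0 < d) (hn : 0 < n) (hdn : d ∣ n) : Per f d a b := by
  have hu := unroll_periodic f a n
  have hle := Int.le_of_dvd hn hdn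
  have hu' : Function.Periodic (unroll f a n) d := by
    intro t
    have h3 := Int.emod_add_mul_ediv (t - a') n
    have h4 := Int.emod_nonneg (t - a') hn.ne'
    have h5 := Int.emod_lt_of_pos (t - a') hn
    have e1 := periodic_of_dvd hu (Dvd.intro ((t - a') / n) rfl) (a' + (t - a') % n)
    have e2 := periodic_of_dvd hu (Dvd.intro ((t - a') / n) rfl) (a' + (t - a') % n + d)
    rw [show a' + (t - a') % n + n * ((t - a') / n) = t by omega] at e1
    rw [show a' + (t - a') % n + d + n * ((t - a') / n) = t + d by omega] at e2
    rw [e1, e2]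
    generalize (t - a') % n = r at *
    by_cases hr : r + d < n
    · rw [unroll_eq h hn (by omega) (by omega), unroll_eq h hn (by omega) (by omega)]
      exact (h' (a' + r) (by omega) (by omega)).symm
    · have e3 := hu.sub_eq (a' + r + d)
      rw [← e3, unroll_eq h hn (by omega) (by omega), unroll_eq h hn (by omega) (by omega)]
      have := h'.of_dvd hd (q := n - d) (by omega) (Dvd.dvd.sub hdn (dvd_refl d))
        (a' + r + d - n) (by omega) (by omega)
      rw [this]; congr 1; omega
  intro t ht1 ht2
  have := hu' t
  rw [unroll_eq h hn ht1 (by omega), unroll_eq h hn (by omega) ht2] at this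
  exact this.symm

/-- If `f` has period `2 * δ` and agrees with its translate by `δ` on a window of length `δ`, then
it has period `δ`. -/
lemma periodic_half {δ O : ℤ} (hf : Function.Periodic f (2 * δ)) (hδ : 0 < δ)
    (h : ∀ t, O ≤ t → t < O + δ → f t = f (t + δ)) : Function.Periodic f δ := by
  intro t
  have h3 := Int.emod_add_mul_ediv (t - O) (2 * δ)
  have h4 := Int.emod_nonneg (t - O) (b := 2 * δ) (by omega)
  have h5 := Int.emod_lt_of_pos (t - O) (b := 2 * δ) (by omega)
  have e1 := periodic_of_dvd hf (Dvd.intro ((t - O) / (2 * δ)) rfl) (O + (t - O) % (2 * δ))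
  have e2 := periodic_of_dvd hf (Dvd.intro ((t - O) / (2 * δ)) rfl) (O + (t - O) % (2 * δ) + δ)
  rw [show O + (t - O) % (2 * δ) + 2 * δ * ((t - O) / (2 * δ)) = t by omega] at e1
  rw [show O + (t - O) % (2 * δ) + δ + 2 * δ * ((t - O) / (2 * δ)) = t + δ by omega] at e2
  rw [e1, e2]
  generalize (t - O) % (2 * δ) = r at *
  by_cases hr : r < δ
  · exact (h (O + r) (by omega) (by omega)).symm
  · have := h (O + r - δ) (by omega) (by omega)
    rw [show O + r - δ + δ = O + r by ring] at this
    rw [← this, ← hf (O + r - δ)]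
    congr 1; ring

lemma Occ.per {n c c' : ℤ} (h : Occ f X n c) (h' : Occ f X n c') :
    Per f (c' - c) c (c' + n) := by
  intro t h1 h2
  have e1 := h (t - c) (by omega) (by omega)
  have e2 := h' (t - c) (by omega) (by omega)
  rw [show c + (t - c) = t by ring] at e1
  rw [show c' + (t - c) = t + (c' - c) by ring] at e2
  rw [e1, e2]

lemma Occ.translate {n m c c' b : ℤ} (h : Occ f Y m c) (hp : Per f n c' b)
    (hc : c' ≤ c) (hb : c + m + n ≤ b) : Occ f Y m (c + n) := by
  intro t h1 h2
  have := hp (c + t) (by omega) (by omega)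
  rw [show c + n + t = c + t + n by ring, ← this]
  exact h t h1 h2

lemma Occ.translate_back {n m c c' b : ℤ} (h : Occ f Y m c) (hp : Per f n c' b)
    (hc : c' ≤ c - n) (hb : c + m ≤ b) : Occ f Y m (c - n) := by
  intro t h1 h2
  have := hp (c - n + t) (by omega) (by omega)
  rw [this, ← h t h1 h2]
  congr 1; ring

/-- A primitive word occurring in a run of period `n` of its own length admits no further period
`d ∣ n` on a window of length `n`. -/
lemma PrimWord.eq_of_per {n d c a b a' b' : ℤ} (hX : PrimWord X n) (ho : Occ f X n c)
    (hc : a ≤ c) (hc' : c + n ≤ b) (h : Per f n a b) (h' : Per f d a' b') (ha : a ≤ a')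
    (hb : b' ≤ b) (hl : n ≤ b' - a') (hd : 0 < d) (hn : 0 < n) (hdn : d ∣ n) : d = n := by
  refine hX d hd hdn ?_
  have := h.extend h' ha hb hl hd hn hdn
  intro t h1 h2
  rw [← ho t h1 (by omega), ← ho (t + d) (by omega) h2, ← add_assoc]
  exact this _ (by omega) (by omega)

/-- In a run of period `n` through an occurrence of a primitive word of length `n`, every period
`d` of a window of length `n + d` is a multiple of `n`. -/
lemma PrimWord.dvd_of_per {n d c a b a' b' : ℤ} (hX : PrimWord X n) (ho : Occ f X n c)
    (hc : a ≤ c) (hc' : c + n ≤ b) (h : Per f n a b) (h' : Per f d a' b') (ha : a ≤ a')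
    (hb : b' ≤ b) (hl : n + d ≤ b' - a') (hd : 0 < d) (hn : 0 < n) : n ∣ d := by
  have hg := (h.mono ha hb).gcd h' hn hd hl
  have := hX.eq_of_per ho hc hc' h hg ha hb (by omega)
    (by exact_mod_cast Int.gcd_pos_of_ne_zero_left _ hn.ne') hn (Int.gcd_dvd_left _ _)
  rw [← this]
  exact Int.gcd_dvd_right _ _

lemma PrimWord.dvd_of_periodic {n d c : ℤ} (hX : PrimWord X n) (ho : Occ f X n c) (hn : 0 < n)
    (h : Function.Periodic f n) (h' : Function.Periodic f d) : n ∣ d := by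
  have := hX.eq_of_per (a := c) (b := c + n) ho le_rfl le_rfl (Per.of_periodic h _ _)
    (Per.of_periodic (periodic_gcd h h') _ _) le_rfl le_rfl (by omega)
    (by exact_mod_cast Int.gcd_pos_of_ne_zero_left _ hn.ne') hn (Int.gcd_dvd_left _ _)
  rw [← this]
  exact Int.gcd_dvd_right _ _

lemma Occ.unroll {n a b c p : ℤ} (ho : Occ f X n c) (h : Per f p a b) (hp : 0 < p) (hc : a ≤ c)
    (hc' : c + n ≤ b) : Occ (unroll f a p) X n c := by
  intro t h1 h2
  rw [unroll_eq h hp (by omega) (by omega)]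
  exact ho t h1 h2

/-- A periodic function with two occurrences of a word that is at least as long as the period also
has the distance of the occurrences as a period. -/
lemma Occ.periodic_sub {n p c c' : ℤ} (h : Occ f X n c) (h' : Occ f X n c')
    (hf : Function.Periodic f p) (hp : 0 < p) (hpn : p ≤ n) : Function.Periodic f (c' - c) :=
  periodic_of_window hf hp (h.per h') (by omega)

/-- Two occurrences of a primitive word in a run whose period is the length of the word are
aligned. -/
lemma PrimWord.dvd_sub {n a b c c' : ℤ} (hX : PrimWord X n) (hn : 0 < n) (h : Per f n a b)
    (ho : Occ f X n c) (hc : a ≤ c) (hc' : c + n ≤ b) (ho' : Occ f X n c') (hd : a ≤ c')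
    (hd' : c' + n ≤ b) : n ∣ c' - c := by
  have h1 := ho.unroll h hn hc hc'
  have h2 := ho'.unroll h hn hd hd'
  exact hX.dvd_of_periodic h1 hn (unroll_periodic _ _ _)
    (h1.periodic_sub h2 (unroll_periodic _ _ _) hn le_rfl)

lemma int_eq_of_dvd {m v : ℤ} (h : m ∣ v) (h0 : 0 < v) (h1 : v < 2 * m) : v = m := by
  obtain ⟨k, rfl⟩ := h
  have : k = 1 := by
    have : 0 < m := by omega
    have : 0 < k := by nlinarith
    have : k < 2 := by nlinarith
    omega
  rw [this, mul_one]

lemma int_not_dvd {m v : ℤ} (h : m ∣ v) (h0 : 0 < v) (h1 : v < m) : False :=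
  absurd (Int.le_of_dvd h0 h) (by omega)

end

/-! ### Occurrences of primitive words in squares -/

section

variable {β : Type*} {f X Y : ℤ → β}

lemma Per.flip {p a b : ℤ} (h : Per f p a b) (e : ℤ) :
    Per (fun t => f (e - t)) p (e + 1 - b) (e + 1 - a) := by
  intro t h1 h2
  have := h (e - (t + p)) (by omega) (by omega)
  rw [show e - (t + p) + p = e - t by ring] at this
  exact this.symm

lemma Occ.flip {n c : ℤ} (h : Occ f X n c) (e : ℤ) :
    Occ (fun t => f (e - t)) (fun t => X (n - 1 - t)) n (e + 1 - n - c) := by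
  intro t h1 h2
  have := h (n - 1 - t) (by omega) (by omega)
  rw [show c + (n - 1 - t) = e - (e + 1 - n - c + t) by ring] at this
  exact this

lemma PrimWord.flip {n : ℤ} (h : PrimWord X n) : PrimWord (fun t => X (n - 1 - t)) n := by
  intro d h1 h2 h3
  refine h d h1 h2 ?_
  have := h3.flip (n - 1)
  simpa using this

/-- A primitive word does not occur inside its own square. -/
lemma PrimWord.no_inner {n c e : ℤ} (hX : PrimWord X n) (h0 : Occ f X n c)
    (h1 : Occ f X n (c + n)) (h2 : Occ f X n e) (hc : c < e) (he : e < c + n) : False := by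
  have p1 := h0.per h1
  have p2 := h0.per h2
  rw [show c + n - c = n by ring] at p1
  have := hX.dvd_of_per h0 (a := c) (b := c + n + n) le_rfl (by omega) p1 p2 le_rfl (by omega)
    (by omega) (by omega) (by omega)
  exact int_not_dvd this (by omega) (by omega)

/-- The square `xx` is not covered by `x y ⋯ y` with `x` overlapping the left end only. -/
lemma square_not_left {n m P : ℤ} (hX : PrimWord X n) (hY : PrimWord Y m) (hm : 0 < m)
    (hmn : m < n) (hP : 0 < P) (hPn : P < n) (o1 : Occ f X n (-P)) (o2 : Occ f X n 0)
    (o3 : Occ f X n n) (oy : Occ f Y m (n - P)) (hp : Per f m (n - P) (2 * n)) : False := by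
  have pn : Per f n 0 (2 * n) := by
    have := o2.per o3
    rwa [sub_zero, ← two_mul] at this
  have pP : Per f P (-P) n := by
    have := o1.per o2
    simpa using this
  by_cases hPm : m ≤ P
  · have := hX.dvd_of_per o2 le_rfl (by omega) pn hp (by omega) le_rfl (by omega) hm (by omega)
    exact int_not_dvd this hm hmn
  · -- shifting the last `P` letters of the first `x` by `m` and back by `n` yields a period
    have pq : Per f (n - m) (m - P) n := by
      intro t h1 h2
      rw [pn t (by omega) (by omega), hp (t + (n - m)) (by omega) (by omega)]
      congr 1; ring
    have pg := pq.gcd (pP.mono (by omega) le_rfl) (by omega) hP (by omega)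
    have gpos : 0 < (Int.gcd (n - m) P : ℤ) := by
      exact_mod_cast Int.gcd_pos_of_ne_zero_right _ hP.ne'
    have gP := Int.gcd_dvd_right (n - m) P
    have gq := Int.le_of_dvd (by omega) (Int.gcd_dvd_left (n - m) P)
    have gP' := Int.le_of_dvd hP gP
    generalize (Int.gcd (n - m) P : ℤ) = g at *
    have pg' : Per f g 0 n :=
      (pP.extend pg (by omega) le_rfl (by omega) gpos hP gP).mono (by omega) le_rfl
    have pg2 : Per f g n (2 * n) := by
      intro t h1 h2
      have e1 := pn (t - n) (by omega) (by omega)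
      have e2 := pn (t - n + g) (by omega) (by omega)
      rw [show t - n + n = t by ring] at e1
      rw [show t - n + g + n = t + g by ring] at e2
      rw [← e1, ← e2]
      exact pg' _ (by omega) (by omega)
    have := hY.dvd_of_per oy le_rfl (by omega) hp pg2 (by omega) le_rfl (by omega) gpos hm
    exact int_not_dvd this gpos (by omega)

/-- The square `xx` does not sit in the middle of `x y ⋯ y x` when the run of `y` has length
`2 * g` with `m < g` and no letter `y` ends in the middle of the run. The run consists of the last
`g` letters of `x` followed by its first `g` letters, and these are conjugate because `x` has the
period `g`. With `h = m / 2` and `r = n mod g`, it follows that the run, extended periodically,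
agrees with its translate by `h + r` on a window of length `g - r`, and with its translate by `r`
on the following window of length `r`. -/
lemma square_balanced {n m g : ℤ} (hX : PrimWord X n) (hY : PrimWord Y m) (hm : 0 < m)
    (hg : m < g) (hgn : g < n) (o1 : Occ f X n (-g)) (o2 : Occ f X n 0)
    (o3 : Occ f X n n) (oy : Occ f Y m (n - g)) (hp : Per f m (n - g) (n + g))
    (hd : ¬ m ∣ g) (hd2 : m ∣ 2 * g) : False := by
  have pn : Per f n 0 (2 * n) := by
    have := o2.per o3
    rwa [sub_zero, ← two_mul] at this
  have pg : Per f g 0 n := by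
    have := o1.per o2
    exact (by simpa using this : Per f g (-g) n).mono (by omega) le_rfl
  obtain ⟨i, hi⟩ : ∃ i, 2 * g = m * (2 * i + 1) := by
    obtain ⟨k, hk⟩ := hd2
    rcases Int.even_or_odd' k with ⟨j, rfl | rfl⟩
    · exact absurd ⟨j, by linarith⟩ hd
    · exact ⟨j, hk⟩
  obtain ⟨h, rfl⟩ : ∃ h, m = 2 * h := by
    refine ⟨g - m * i, ?_⟩
    linarith
  have hi' : g = 2 * h * i + h := by linarith
  -- `r` is the remainder of `n` modulo `g`
  have hr1 := Int.emod_add_mul_ediv n g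
  have hr2 := Int.emod_nonneg n (b := g) (by omega)
  have hr3 := Int.emod_lt_of_pos n (b := g) (by omega)
  have hr0 : n % g ≠ 0 := by
    intro h0
    have := hX.eq_of_per o2 le_rfl (by omega) pn pg le_rfl (by omega) (by omega) (by omega)
      (by omega) (Int.dvd_of_emod_eq_zero h0)
    omega
  have hk1 : 1 ≤ n / g := by
    by_contra hk
    have : g * (n / g) ≤ 0 := by nlinarith
    omega
  have hk2 : 0 ≤ g * (n / g) := by nlinarith
  have hk3 : 0 ≤ g * (n / g - 1) := by nlinarith
  generalize n % g = r at *
  generalize n / g = t at *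
  have A1 : ∀ j, 0 ≤ j → j < g - r → f (n - g + j) = f (n + r + j) := by
    intro j h1 h2
    have e1 := pg.of_dvd (by omega) hk3 ⟨_, rfl⟩ (r + j) (by omega) (by nlinarith)
    have e2 := pn (r + j) (by omega) (by omega)
    rw [show n - g + j = r + j + g * (t - 1) by linarith, ← e1, e2]
    congr 1; ring
  have A2 : ∀ j, g - r ≤ j → j < g → f (n - g + j) = f (n - g + r + j) := by
    intro j h1 h2
    have e1 := pg.of_dvd (by omega) hk2 ⟨_, rfl⟩ (r + j - g) (by omega) (by nlinarith)
    have e2 := pn (r + j - g) (by omega) (by omega)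
    rw [show n - g + j = r + j - g + g * t by linarith, ← e1, e2]
    congr 1; ring
  have hF := unroll_periodic f (n - g) (2 * h)
  have oF := oy.unroll hp hm le_rfl (by omega)
  have uF := fun t => @unroll_eq _ f (2 * h) (n - g) (n + g) t hp hm
  generalize unroll f (n - g) (2 * h) = F at *
  have hFg : ∀ t, F (t + g) = F (t + h) := by
    intro t
    have := periodic_of_dvd hF ⟨i, rfl⟩ (t + h)
    rw [← this]; congr 1; linarith
  have B1 : ∀ t, n - g ≤ t → t < n - r → F t = F (t + (h + r)) := by
    intro t h1 h2
    have := A1 (t - (n - g)) (by omega) (by omega)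
    rw [← uF _ (by omega) (by omega), ← uF _ (by omega) (by omega)] at this
    rw [show n - g + (t - (n - g)) = t by ring,
      show n + r + (t - (n - g)) = t + r + g by ring, hFg] at this
    rw [this]; congr 1; ring
  have B2 : ∀ t, n - r ≤ t → t < n → F t = F (t + r) := by
    intro t h1 h2
    have := A2 (t - (n - g)) (by omega) (by omega)
    rw [← uF _ (by omega) (by omega), ← uF _ (by omega) (by omega)] at this
    rw [show n - g + (t - (n - g)) = t by ring,
      show n - g + r + (t - (n - g)) = t + r by ring] at this
    exact this
  have noh : ¬ Function.Periodic F h := by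
    intro hh
    have := hY.dvd_of_periodic oF hm hF hh
    exact int_not_dvd this (by omega) (by omega)
  have ndh : ¬ 2 * h ∣ h := fun hh => int_not_dvd hh (by omega) (by omega)
  have C1 : 2 * h ≤ g - r → 2 * h ∣ h + r := by
    intro hl
    refine hY.dvd_of_periodic oF hm hF
      (periodic_of_window (a := n - g) (b := n + h) hF hm ?_ (by omega))
    intro t h1 h2
    exact B1 t h1 (by omega)
  have C2 : 2 * h ≤ r → 2 * h ∣ r := by
    intro hl
    refine hY.dvd_of_periodic oF hm hF
      (periodic_of_window (a := n - r) (b := n + r) hF hm ?_ (by omega))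
    intro t h1 h2
    exact B2 t h1 (by omega)
  by_cases c1 : 2 * h ≤ g - r <;> by_cases c2 : 2 * h ≤ r
  · have := dvd_sub (C1 c1) (C2 c2)
    rw [add_sub_cancel_right] at this
    exact ndh this
  · have := int_eq_of_dvd (C1 c1) (by omega) (by omega)
    obtain rfl : r = h := by omega
    exact noh (periodic_half hF (by omega) (O := n - r) fun t h1 h2 => B2 t h1 (by omega))
  · have hh : 2 * h ∣ g - r + h := by
      obtain ⟨q, hq⟩ := C2 c2
      exact ⟨i + 1 - q, by linarith⟩
    have := int_eq_of_dvd hh (by omega) (by omega)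
    refine noh (periodic_half hF (by omega) (O := n - g) fun t h1 h2 => ?_)
    rw [B1 t h1 (by omega), ← hFg]
    rw [← periodic_of_dvd hF (C2 c2) (t + g)]
    have e := hFg (t + r)
    rw [show t + r + h = t + (h + r) by ring] at e
    rw [← e]; congr 1; ring
  · -- the remaining case is `g = 3 * h`, where `e = r - h` and `h - e` both act as periods
    obtain rfl : i = 1 := by
      have : 0 < i := by nlinarith
      have : i < 2 := by nlinarith
      omega
    have hF2 : ∀ t, F (t + 2 * h) = F t := hF
    have pe : Per F (r - h) (n - g) (n - g + 2 * h) := by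
      intro t h1 h2
      rw [B1 t h1 (by omega), ← hF2 (t + (r - h))]
      congr 1; ring
    have phe : Per F (2 * h - r) (n - g) (n - g + h) := by
      intro t h1 h2
      have := B2 (t + (2 * h - r) + 2 * h) (by omega) (by omega)
      rw [hF2] at this
      rw [this, ← hF2 t, ← hF2 (t + 2 * h)]
      congr 1; ring
    have pd := (pe.mono le_rfl (by omega : n - g + h ≤ _)).gcd phe (by omega) (by omega) (by omega)
    have dpos : 0 < (Int.gcd (r - h) (2 * h - r) : ℤ) := by
      exact_mod_cast Int.gcd_pos_of_ne_zero_left _ (by omega)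
    have d1 := Int.gcd_dvd_left (r - h) (2 * h - r)
    have d2 := Int.gcd_dvd_right (r - h) (2 * h - r)
    generalize (Int.gcd (r - h) (2 * h - r) : ℤ) = d at *
    have pd' := pe.extend pd le_rfl (by omega) (by omega) dpos (by omega) d1
    have d3 : d ∣ 2 * h := by
      have := dvd_add d1 d2
      rw [show r - h + (2 * h - r) = h by ring] at this
      exact this.mul_left 2
    have := hY.eq_of_per oF le_rfl (by omega : _ ≤ n - g + 2 * h) (Per.of_periodic hF _ _) pd'
      le_rfl le_rfl (by omega) dpos (by omega) d3
    have := Int.le_of_dvd (by omega) d1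
    omega

lemma Per.zero_two_mul {n : ℤ} (o2 : Occ f X n 0) (o3 : Occ f X n n) : Per f n 0 (2 * n) := by
  have := o2.per o3
  rwa [sub_zero, ← two_mul] at this

/-- The square `xx` is not covered by `x y ⋯ y x` with overlaps `P > m > S` on the left and on the
right, if `P + S ≤ n`. Here `P` and `S` are periods of `x`, and so is their greatest common
divisor. -/
lemma square_short {n m P S k : ℤ} (hY : PrimWord Y m) (hm : 0 < m)
    (hS : 0 < S) (hSm : S < m) (hmP : m < P) (hPn : P + S ≤ n)
    (hk : P + S = m * k) (hk2 : 2 ≤ k)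
    (o1 : Occ f X n (-P)) (o2 : Occ f X n 0) (o3 : Occ f X n n) (o4 : Occ f X n (n + S))
    (oy : Occ f Y m (n - P)) (hp : Per f m (n - P) (n + S)) : False := by
  have pn := Per.zero_two_mul o2 o3
  have pP : Per f P 0 n :=
    (by simpa using o1.per o2 : Per f P (-P) n).mono (by omega) le_rfl
  have pS : Per f S 0 n := by
    intro t h1 h2
    have := o3.per o4 (n + t) (by omega) (by omega)
    rw [show n + S - n = S by ring] at this
    have e1 := pn t (by omega) (by omega)
    have e2 := pn (t + S) (by omega) (by omega)
    rw [e1, e2, add_comm t n, this]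
    congr 1; ring
  have pg := pP.gcd pS (by omega) hS (by omega)
  have gpos : 0 < (Int.gcd P S : ℤ) := by
    exact_mod_cast Int.gcd_pos_of_ne_zero_right _ hS.ne'
  have g1 := Int.gcd_dvd_left P S
  have g2 := Int.gcd_dvd_right P S
  generalize (Int.gcd P S : ℤ) = g at *
  have gS := Int.le_of_dvd hS g2
  have hPg : P < m + g := by
    by_contra hc
    have := hY.dvd_of_per oy (a := n - P) (b := n + S) le_rfl (by omega) hp
      (pg.mono (by omega : 0 ≤ n - P) le_rfl) le_rfl (by omega) (by omega) gpos hm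
    exact int_not_dvd this gpos (by omega)
  obtain rfl : k = 2 := by
    have : k < 3 := by nlinarith
    omega
  -- `P = m + δ` and `S = m - δ` with `g = 2 * δ`
  obtain ⟨δ, rfl⟩ : ∃ δ, P = m + δ := ⟨P - m, by ring⟩
  obtain rfl : S = m - δ := by omega
  have hgd : g ∣ 2 * δ := by
    have := dvd_sub g1 g2
    rwa [show m + δ - (m - δ) = 2 * δ by ring] at this
  obtain rfl := int_eq_of_dvd hgd (by omega) (by omega)
  obtain ⟨c, hc⟩ := g1
  have hF := unroll_periodic f 0 (2 * δ)
  have uF := fun t => @unroll_eq _ f (2 * δ) 0 n t pg gpos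
  have hFd : Function.Periodic (unroll f 0 (2 * δ)) δ := by
    refine periodic_half hF (by omega) (O := n - (m + δ)) fun t h1 h2 => ?_
    have e := hp t h1 (by omega)
    rw [← uF t (by omega) (by omega), ← uF (t + m) (by omega) (by omega)] at e
    rw [e, ← periodic_of_dvd hF ⟨c - 1, rfl⟩ (t + δ)]
    congr 1; linarith
  have pd : Per f δ 0 n := by
    intro t h1 h2
    rw [← uF t (by omega) (by omega), ← uF (t + δ) (by omega) (by omega)]
    exact (hFd t).symm
  have := hY.eq_of_per oy (a := n - (m + δ)) (b := n) le_rfl (by omega)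
    (hp.mono le_rfl (by omega)) (pd.mono (by omega) le_rfl) le_rfl le_rfl (by omega) (by omega) hm
    ⟨2 * c - 1, by linarith⟩
  omega

/-- The square `xx` is not covered by `x y ⋯ y x` with overlaps `P > m > S` on the left and on the
right, if `P + S > n` and `xx` is preceded by `y`. The preceding `y` reappears in `x` at distance
`P`, and has to be aligned with the run of `y` unless there are exactly two letters `y`. -/
lemma square_long {n m P S k : ℤ} (hX : PrimWord X n) (hY : PrimWord Y m) (hm : 0 < m)
    (hS : 0 < S) (hSm : S < m) (hmP : m < P) (hPn : P < n) (hnPS : n < P + S)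
    (hk : P + S = m * k) (hk2 : 2 ≤ k)
    (o1 : Occ f X n (-P)) (o2 : Occ f X n 0) (o3 : Occ f X n n) (o4 : Occ f X n (n + S))
    (oy : Occ f Y m (n - P)) (hp : Per f m (n - P) (n + S)) (oy0 : Occ f Y m (-m)) : False := by
  have pn := Per.zero_two_mul o2 o3
  have pP' : Per f P (-P) n := by simpa using o1.per o2
  have pS : Per f S 0 n := by
    intro t h1 h2
    have := o3.per o4 (n + t) (by omega) (by omega)
    rw [show n + S - n = S by ring] at this
    have e1 := pn t (by omega) (by omega)
    have e2 := pn (t + S) (by omega) (by omega)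
    rw [e1, e2, add_comm t n, this]
    congr 1; ring
  have ndS : ¬ m ∣ S := fun h => int_not_dvd h hS hSm
  have hR : P + S < n + m := by
    by_contra hc
    have hmn : m < n := by omega
    have := hX.dvd_of_per o2 le_rfl (by omega) pn (hp.mono le_rfl (le_refl _))
      (by omega) (by omega) (by omega) hm (by omega)
    exact int_not_dvd this hm hmn
  have oyP : Occ f Y m (P - m) := by
    have := oy0.translate pP' (by omega) (by omega)
    rwa [show -m + P = P - m by ring] at this
  have hA : n + m ≤ 2 * P → n + S - P = m := by
    intro h2
    have d1 := hY.dvd_sub hm hp oy le_rfl (by omega) oyP (by omega) (by omega)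
    have d2 : m ∣ n + S - P := by
      obtain ⟨q, hq⟩ := d1
      exact ⟨k - 1 - q, by linarith⟩
    exact int_eq_of_dvd d2 (by omega) (by omega)
  obtain rfl : k = 2 := by
    by_contra hk3
    have hk3 : 3 ≤ k := by omega
    have h3 : m * 3 ≤ m * k := by nlinarith
    exact ndS (hY.dvd_of_per oy (a := n - P) (b := n) le_rfl (by omega) (hp.mono le_rfl (by omega))
      (pS.mono (by omega : 0 ≤ n - P) le_rfl) le_rfl le_rfl (by omega) hS hm)
  obtain rfl : P = 2 * m - S := by omega
  have hSe : m ≤ n + S - (2 * m - S) := by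
    by_cases h2 : n + m ≤ 2 * (2 * m - S)
    · exact (hA h2).ge
    · omega
  -- in the only remaining case, `x` starts with a run of period `n - m` of length `n - m + S`
  have pe : Per f (n - m) 0 (n - m + S) := by
    intro t h1 h2
    rw [pn t h1 (by omega)]
    have := hp (t + (n - m)) (by omega) (by omega)
    rw [this]; congr 1; ring
  have pd := pe.gcd (pS.mono le_rfl (by omega)) (by omega) hS (by omega)
  have dpos : 0 < (Int.gcd (n - m) S : ℤ) := by
    exact_mod_cast Int.gcd_pos_of_ne_zero_right _ hS.ne'
  have d1 := Int.gcd_dvd_left (n - m) S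
  have d2 := Int.gcd_dvd_right (n - m) S
  generalize (Int.gcd (n - m) S : ℤ) = d at *
  have dS := Int.le_of_dvd hS d2
  have pd' : Per f d 0 n := pS.extend pd le_rfl (by omega) (by omega) dpos hS d2
  have hG := unroll_periodic f 0 d
  have uG := fun t => @unroll_eq _ f d 0 n t pd' dpos
  have oG1 := oyP.unroll pd' dpos (by omega) (by omega)
  have oG2 := oy.unroll pd' dpos (by omega) (by omega)
  have hG1 := oG1.periodic_sub oG2 hG dpos (by omega)
  generalize unroll f 0 d = G at *
  -- `G` has the periods `d` and `2 * m`
  have hG2 : Function.Periodic G (2 * m) := by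
    have e1 := periodic_of_dvd hG d1
    have e2 := periodic_of_dvd hG d2
    have := (e1.sub_period hG1).add_period (e2.add_period e2)
    rwa [show n - m - (n - (2 * m - S) - (2 * m - S - m)) + (S + S) = 2 * m by ring] at this
  have hG3 := periodic_gcd hG hG2
  have d3pos : 0 < (Int.gcd d (2 * m) : ℤ) := by
    exact_mod_cast Int.gcd_pos_of_ne_zero_left _ dpos.ne'
  have d31 := (Int.gcd_dvd_left d (2 * m)).trans d2
  have d32 := Int.gcd_dvd_right d (2 * m)
  generalize (Int.gcd d (2 * m) : ℤ) = c at *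
  have cS := Int.le_of_dvd hS d31
  have pc : Per f c 0 n := by
    intro t h1 h2
    rw [← uG t (by omega) (by omega), ← uG (t + c) (by omega) (by omega)]
    exact (hG3 t).symm
  have hmc : m < S + c := by
    by_contra hc
    have := hY.dvd_of_per oy (a := n - (2 * m - S)) (b := n) le_rfl (by omega)
      (hp.mono le_rfl (by omega)) (pc.mono (by omega : 0 ≤ n - (2 * m - S)) le_rfl) le_rfl le_rfl
      (by omega) d3pos hm
    exact int_not_dvd this d3pos (by omega)
  have hc2 : c ∣ 2 * (m - S) := by
    have := dvd_sub d32 (d31.mul_left 2)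
    rwa [← mul_sub] at this
  obtain rfl := int_eq_of_dvd hc2 (by omega) (by omega)
  obtain ⟨q, hq⟩ := d31
  have hGe : Function.Periodic G (m - S) := by
    refine periodic_half hG3 (by omega) (O := n - (2 * m - S)) fun t h1 h2 => ?_
    have e := hp t h1 (by omega)
    rw [← uG t (by omega) (by omega), ← uG (t + m) (by omega) (by omega)] at e
    rw [e, ← periodic_of_dvd hG3 ⟨q, rfl⟩ (t + (m - S))]
    congr 1; linarith
  have pee : Per f (m - S) 0 n := by
    intro t h1 h2
    rw [← uG t (by omega) (by omega), ← uG (t + (m - S)) (by omega) (by omega)]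
    exact (hGe t).symm
  have := hY.eq_of_per oy (a := n - (2 * m - S)) (b := n) le_rfl (by omega)
    (hp.mono le_rfl (by omega)) (pee.mono (by omega) le_rfl) le_rfl le_rfl (by omega) (by omega) hm
    ⟨2 * q + 1, by linarith⟩
  omega

/-- The case of `square_not_pow` where the right overlap `S` is at most the left one. -/
lemma square_not_pow_of_le {n m P S k : ℤ} (hX : PrimWord X n) (hY : PrimWord Y m) (hm : 0 < m)
    (hS : 0 < S) (hSP : S ≤ P) (hPn : P < n) (hk : P + S = m * k) (hk2 : 2 ≤ k) (hmP : ¬ m ∣ P)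
    (o1 : Occ f X n (-P)) (o2 : Occ f X n 0) (o3 : Occ f X n n) (o4 : Occ f X n (n + S))
    (oy : Occ f Y m (n - P)) (hp : Per f m (n - P) (n + S)) (oy0 : Occ f Y m (-m))
    (oy1 : Occ f Y m (2 * n)) : False := by
  have h2 : m * 2 ≤ m * k := by nlinarith
  have hmP1 : m < P := by
    rcases lt_trichotomy m P with h | rfl | h
    · exact h
    · exact absurd (dvd_refl _) hmP
    · omega
  have hmS : ¬ m ∣ S := by
    rintro ⟨q, hq⟩
    exact hmP ⟨k - q, by linarith⟩
  rcases lt_trichotomy S m with h | rfl | h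
  · by_cases h3 : P + S ≤ n
    · exact square_short hY hm hS h hmP1 h3 hk hk2 o1 o2 o3 o4 oy hp
    · exact square_long hX hY hm hS h hmP1 hPn (by omega) hk hk2 o1 o2 o3 o4 oy hp oy0
  · exact hmS (dvd_refl _)
  · have pn := Per.zero_two_mul o2 o3
    have pS : Per f S n (2 * n + S) := by
      have := o3.per o4
      rwa [show n + S - n = S by ring, show n + S + n = 2 * n + S by ring] at this
    have pS0 : Per f S 0 n := by
      intro t h1 h2
      have := pS (n + t) (by omega) (by omega)
      have e1 := pn t (by omega) (by omega)
      have e2 := pn (t + S) (by omega) (by omega)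
      rw [e1, e2, add_comm t n, this]
      congr 1; ring
    have oyS : Occ f Y m (n - S) := by
      have := (oy1.translate_back pS (by omega) (by omega)).translate_back pn (by omega) (by omega)
      rwa [show 2 * n - S - n = n - S by ring] at this
    have d1 := hY.dvd_sub hm hp oy le_rfl (by omega) oyS (by omega) (by omega)
    by_cases hPS : P = S
    · subst hPS
      exact square_balanced hX hY hm h hPn o1 o2 o3 oy hp hmS ⟨k, by linarith⟩
    · have := Int.le_of_dvd (by omega) d1
      exact hmS (hY.dvd_of_per oy (a := n - P) (b := n) le_rfl (by omega)
        (hp.mono le_rfl (by omega)) (pS0.mono (by omega : 0 ≤ n - P) le_rfl) le_rfl le_rfl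
        (by omega) hS hm)

/-- The square `xx`, when preceded and followed by `y`, is not covered by `x y ⋯ y x` with two or
more letters `y`. -/
lemma square_not_pow {n m P S k : ℤ} (hX : PrimWord X n) (hY : PrimWord Y m) (hm : 0 < m)
    (hP : 0 < P) (hS : 0 < S) (hPn : P < n) (hSn : S < n) (hk : P + S = m * k) (hk2 : 2 ≤ k)
    (hmP : ¬ m ∣ P) (o1 : Occ f X n (-P)) (o2 : Occ f X n 0) (o3 : Occ f X n n)
    (o4 : Occ f X n (n + S)) (oy : Occ f Y m (n - P)) (oy' : Occ f Y m (n + S - m))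
    (hp : Per f m (n - P) (n + S)) (oy0 : Occ f Y m (-m)) (oy1 : Occ f Y m (2 * n)) : False := by
  rcases le_total S P with h | h
  · exact square_not_pow_of_le hX hY hm hS h hPn hk hk2 hmP o1 o2 o3 o4 oy hp oy0 oy1
  · have hmS : ¬ m ∣ S := by
      rintro ⟨q, hq⟩
      exact hmP ⟨k - q, by linarith⟩
    have r1 := o1.flip (2 * n - 1)
    have r2 := o2.flip (2 * n - 1)
    have r3 := o3.flip (2 * n - 1)
    have r4 := o4.flip (2 * n - 1)
    have ry' := oy'.flip (2 * n - 1)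
    have rp := hp.flip (2 * n - 1)
    have ry0 := oy0.flip (2 * n - 1)
    have ry1 := oy1.flip (2 * n - 1)
    rw [show 2 * n - 1 + 1 - n - -P = n + P by ring] at r1
    rw [show 2 * n - 1 + 1 - n - 0 = n by ring] at r2
    rw [show 2 * n - 1 + 1 - n - n = 0 by ring] at r3
    rw [show 2 * n - 1 + 1 - n - (n + S) = -S by ring] at r4
    rw [show 2 * n - 1 + 1 - m - (n + S - m) = n - S by ring] at ry'
    rw [show 2 * n - 1 + 1 - (n + S) = n - S by ring,
      show 2 * n - 1 + 1 - (n - P) = n + P by ring] at rp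
    rw [show 2 * n - 1 + 1 - m - -m = 2 * n by ring] at ry0
    rw [show 2 * n - 1 + 1 - m - 2 * n = -m by ring] at ry1
    exact square_not_pow_of_le hX.flip hY.flip hm hP h hSn (by rw [add_comm, hk]) hk2 hmS
      r4 r3 r2 r1 ry' rp ry1 ry0

/-- The mirror image of `square_not_left`. -/
lemma square_not_right {n m S : ℤ} (hX : PrimWord X n) (hY : PrimWord Y m) (hm : 0 < m)
    (hmn : m < n) (hS : 0 < S) (hSn : S < n) (o2 : Occ f X n 0) (o3 : Occ f X n n)
    (o4 : Occ f X n (n + S)) (oy : Occ f Y m (n + S - m)) (hp : Per f m 0 (n + S)) : False := by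
  have r2 := o2.flip (2 * n - 1)
  have r3 := o3.flip (2 * n - 1)
  have r4 := o4.flip (2 * n - 1)
  have ry := oy.flip (2 * n - 1)
  have rp := hp.flip (2 * n - 1)
  rw [show 2 * n - 1 + 1 - n - 0 = n by ring] at r2
  rw [show 2 * n - 1 + 1 - n - n = 0 by ring] at r3
  rw [show 2 * n - 1 + 1 - n - (n + S) = -S by ring] at r4
  rw [show 2 * n - 1 + 1 - m - (n + S - m) = n - S by ring] at ry
  rw [show 2 * n - 1 + 1 - (n + S) = n - S by ring, show 2 * n - 1 + 1 - 0 = 2 * n by ring] at rp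
  exact square_not_left hX.flip hY.flip hm hmn hS hSn r4 r3 r2 ry rp

/-- If `xx`, preceded and followed by `y`, is covered by `xyx`, then it sits in the middle. -/
lemma square_centered {n m P S : ℤ} (hY : PrimWord Y m) (hmn : m < n)
    (hP : 0 < P) (hS : 0 < S) (hk : P + S = m) (o1 : Occ f X n (-P)) (o2 : Occ f X n 0)
    (o3 : Occ f X n n) (o4 : Occ f X n (n + S)) (oy : Occ f Y m (n - P))
    (oy0 : Occ f Y m (-m)) (oy1 : Occ f Y m (2 * n)) : P = S := by
  have pn := Per.zero_two_mul o2 o3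
  have pP : Per f P (-P) n := by simpa using o1.per o2
  have pS : Per f S n (2 * n + S) := by
    have := o3.per o4
    rwa [show n + S - n = S by ring, show n + S + n = 2 * n + S by ring] at this
  have pS0 : Per f S 0 n := by
    intro t h1 h2
    have := pS (n + t) (by omega) (by omega)
    have e1 := pn t (by omega) (by omega)
    have e2 := pn (t + S) (by omega) (by omega)
    rw [e1, e2, add_comm t n, this]
    congr 1; ring
  have pg := (pP.mono (by omega : -P ≤ 0) le_rfl).gcd pS0 hP hS (by omega)
  have gpos : 0 < (Int.gcd P S : ℤ) := by
    exact_mod_cast Int.gcd_pos_of_ne_zero_right _ hS.ne'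
  have g1 := Int.gcd_dvd_left P S
  have g2 := Int.gcd_dvd_right P S
  generalize (Int.gcd P S : ℤ) = g at *
  have gP := Int.le_of_dvd hP g1
  have gS := Int.le_of_dvd hS g2
  have gm : g ∣ m := hk ▸ dvd_add g1 g2
  have qP : Per f g (-P) n := pP.extend pg (by omega) le_rfl (by omega) gpos hP g1
  have pgn : Per f g n (2 * n) := by
    intro t h1 h2
    have e1 := pn (t - n) (by omega) (by omega)
    have e2 := pn (t - n + g) (by omega) (by omega)
    rw [show t - n + n = t by ring] at e1
    rw [show t - n + g + n = t + g by ring] at e2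
    rw [← e1, ← e2]
    exact pg _ (by omega) (by omega)
  have qS : Per f g n (2 * n + S) := pS.extend pgn le_rfl (by omega) (by omega) gpos hS g2
  -- in the occurrence of `y` inside `xx`, the first `P` and the last `S` letters have period `g`
  have y1 : Per Y g 0 P := by
    intro t h1 h2
    rw [← oy t h1 (by omega), ← oy (t + g) (by omega) (by omega), ← add_assoc]
    exact qP _ (by omega) (by omega)
  have y2 : Per Y g P m := by
    intro t h1 h2
    rw [← oy t (by omega) (by omega), ← oy (t + g) (by omega) (by omega), ← add_assoc]
    exact qS _ (by omega) (by omega)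
  have y3 : Per Y g 0 S := by
    intro t h1 h2
    rw [← oy1 t h1 (by omega), ← oy1 (t + g) (by omega) (by omega), ← add_assoc]
    exact qS _ (by omega) (by omega)
  have y4 : Per Y g S m := by
    intro t h1 h2
    rw [← oy0 t (by omega) (by omega), ← oy0 (t + g) (by omega) (by omega), ← add_assoc]
    exact qP _ (by omega) (by omega)
  have key : ∀ a, 0 ≤ a → Per Y g 0 (a + g) → Per Y g a m → False := by
    intro a ha q1 q2
    have : g = m := by
      refine hY g gpos gm fun t h1 h2 => ?_
      by_cases h : t < a
      · exact q1 t h1 (by omega)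
      · exact q2 t (by omega) h2
    omega
  rcases lt_trichotomy P S with h | h | h
  · have := Int.le_of_dvd (by omega) (dvd_sub g2 g1)
    exact (key P hP.le (y3.mono le_rfl (by omega)) y2).elim
  · exact h
  · have := Int.le_of_dvd (by omega) (dvd_sub g1 g2)
    exact (key S hS.le (y1.mono le_rfl (by omega)) y4).elim

end

/-! ### Factorizations of bi-infinite words -/

section

variable {β : Type*} {f X Y : ℤ → β}

/-- The bi-infinite word `f` is factored into consecutive letters `x` and `y`, of lengths `n` and
`m`: the letter number `j` starts at position `cut j`, and it is `x` if `isX j`, and `y`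
otherwise. -/
structure IsParse (f X Y : ℤ → β) (n m : ℤ) (cut : ℤ → ℤ) (isX : ℤ → Prop) : Prop where
  x_step : ∀ j, isX j → cut (j + 1) = cut j + n
  y_step : ∀ j, ¬ isX j → cut (j + 1) = cut j + m
  x_occ : ∀ j, isX j → Occ f X n (cut j)
  y_occ : ∀ j, ¬ isX j → Occ f Y m (cut j)

namespace IsParse

variable {n m : ℤ} {cut : ℤ → ℤ} {isX : ℤ → Prop}

lemma shift (h : IsParse f X Y n m cut isX) (c : ℤ) :
    IsParse (fun t => f (c + t)) X Y n m (fun j => cut j - c) isX where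
  x_step j hj := by rw [h.x_step j hj]; ring
  y_step j hj := by rw [h.y_step j hj]; ring
  x_occ j hj t h1 h2 := by
    rw [← h.x_occ j hj t h1 h2]; exact congrArg f (by ring)
  y_occ j hj t h1 h2 := by
    rw [← h.y_occ j hj t h1 h2]; exact congrArg f (by ring)

lemma swap (h : IsParse f X Y n m cut isX) : IsParse f Y X m n cut (fun j => ¬ isX j) where
  x_step := h.y_step
  y_step j hj := h.x_step j (not_not.1 hj)
  x_occ := h.y_occ
  y_occ j hj := h.x_occ j (not_not.1 hj)

lemma strictMono (h : IsParse f X Y n m cut isX) (hn : 0 < n) (hm : 0 < m) : StrictMono cut := by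
  refine strictMono_int_of_lt_succ fun j => ?_
  by_cases hj : isX j
  · rw [h.x_step j hj]; omega
  · rw [h.y_step j hj]; omega

lemma exists_cover (h : IsParse f X Y n m cut isX) (hn : 0 < n) (hm : 0 < m) (t : ℤ) :
    ∃ j, cut j ≤ t ∧ t < cut (j + 1) := by
  have hs := h.strictMono hn hm
  have hg : ∀ i j, i ≤ j → cut i + (j - i) ≤ cut j := by
    intro i j hij
    induction j, hij using Int.leInduction with
    | base => simp
    | succ j _ ih => have := hs (lt_add_one j); omega
  obtain ⟨j, hj1, hj2⟩ := Int.exists_greatest_of_bdd (P := fun j => cut j ≤ t)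
    ⟨max 0 (t - cut 0), fun z hz => by
      by_contra hc
      have := hg 0 z (by omega)
      omega⟩
    ⟨min 0 (t - cut 0), by have := hg (min 0 (t - cut 0)) 0 (by omega); omega⟩
  refine ⟨j, hj1, ?_⟩
  by_contra hc
  have := hj2 (j + 1) (by omega)
  omega

/-- A run of letters `y` has period `m`. -/
lemma run (h : IsParse f X Y n m cut isX) (hm : 0 < m) {p q : ℤ} (hpq : p ≤ q)
    (hy : ∀ i, p ≤ i → i < q → ¬ isX i) :
    cut q = cut p + m * (q - p) ∧ Per f m (cut p) (cut q) := by
  induction q, hpq using Int.leInduction with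
  | base => exact ⟨by ring, fun t h1 h2 => by omega⟩
  | succ q hq ih =>
    obtain ⟨e, hp⟩ := ih fun i h1 h2 => hy i h1 (by omega)
    have hstep := h.y_step q (hy q hq (by omega))
    refine ⟨by rw [hstep, e]; ring, fun t h1 h2 => ?_⟩
    rcases eq_or_lt_of_le hq with rfl | hq
    · omega
    · have hy' := hy (q - 1) (by omega) (by omega)
      have hstep' := h.y_step (q - 1) hy'
      rw [sub_add_cancel] at hstep'
      by_cases ht : t < cut (q - 1)
      · exact hp t h1 (by omega)
      · have := (h.y_occ (q - 1) hy').per (h.y_occ q (hy q hq.le (by omega))) t (by omega)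
          (by omega)
        rwa [show cut q - cut (q - 1) = m by omega] at this

end IsParse

variable {n m : ℤ} {cA cB : ℤ → ℤ} {xA xB : ℤ → Prop}

/-- The case of `square_cover` where `xx` starts at position `0`. -/
lemma square_cover_zero (hX : PrimWord X n) (hY : PrimWord Y m) (hm : 0 < m) (hmn : m < n)
    (hA : IsParse f X Y n m cA xA) (hB : IsParse f X Y n m cB xB)
    (hd : ∀ i j, cA i ≠ cB j) {i : ℤ} (h0 : cA i = 0) (hi : xA i) (hi' : xA (i + 1)) :
    ¬ xA (i + 2) ∧ ∃ j, 2 * cB j = -m ∧ xB j ∧ ¬ xB (j + 1) ∧ xB (j + 2) ∧ xB (j + 3) := by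
  have hn : 0 < n := by omega
  have c1 := hA.x_step i hi
  have c2 := hA.x_step (i + 1) hi'
  rw [h0, zero_add] at c1
  rw [c1, show i + 1 + 1 = i + 2 by ring, ← two_mul] at c2
  have o2 := hA.x_occ i hi
  have o3 := hA.x_occ (i + 1) hi'
  rw [h0] at o2
  rw [c1] at o3
  have pn := Per.zero_two_mul o2 o3
  obtain ⟨j, j1, j2⟩ := hB.exists_cover hn hm 0
  obtain ⟨e, e1, e2⟩ := hB.exists_cover hn hm (2 * n)
  have hmono := hB.strictMono hn hm
  have dj : cB j ≠ 0 := fun h => hd i j (by rw [h0, h])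
  have de : cB e ≠ 2 * n := fun h => hd (i + 2) e (by rw [c2, h])
  have dn : ∀ k, cB k ≠ n := fun k h => hd (i + 1) k (by rw [c1, h])
  have hje : j < e := by
    rcases lt_trichotomy j e with h | rfl | h
    · exact h
    · by_cases hx : xB j
      · have := hB.x_step j hx; omega
      · have := hB.y_step j hx; omega
    · have := hmono.monotone (show e + 1 ≤ j by omega); omega
  have hmid : ∀ k, j < k → k < e → ¬ xB k := by
    intro k k1 k2 hk
    have s1 := hmono.monotone (show j + 1 ≤ k by omega)
    have s2 := hmono.monotone (show k + 1 ≤ e by omega)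
    have := hB.x_step k hk
    exact hX.no_inner o2 (by rwa [zero_add]) (hB.x_occ k hk) (by omega) (by omega)
  by_cases xj : xB j <;> by_cases xe : xB e
  · have sj := hB.x_step j xj
    have se := hB.x_step e xe
    obtain ⟨r1, r2⟩ := hB.run hm (show j + 1 ≤ e by omega) fun k k1 k2 => hmid k (by omega) k2
    have oj := hB.x_occ j xj
    have oe := hB.x_occ e xe
    obtain ⟨P, hP⟩ : ∃ P, cB j = -P := ⟨-cB j, by ring⟩
    obtain ⟨S, hS⟩ : ∃ S, cB e = n + S := ⟨cB e - n, by ring⟩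
    have hj1 : cB (j + 1) = n - P := by omega
    rw [hP] at oj
    rw [hS] at oe
    have dne := dn e
    have nA2 : ¬ xA (i + 2) := by
      intro hx
      have o := hA.x_occ _ hx
      rw [c2] at o
      exact hX.no_inner o3 (by rwa [← two_mul]) oe (by omega) (by omega)
    have nA1 : ¬ xA (i - 1) := by
      intro hx
      have o := hA.x_occ _ hx
      have := hA.x_step _ hx
      rw [sub_add_cancel, h0] at this
      rw [show cA (i - 1) = -n by omega] at o
      exact hX.no_inner o (by rwa [neg_add_cancel]) oj (by omega) (by omega)
    have oy1 := hA.y_occ _ nA2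
    rw [c2] at oy1
    have oy0 := hA.y_occ _ nA1
    have := hA.y_step _ nA1
    rw [sub_add_cancel, h0] at this
    rw [show cA (i - 1) = -m by omega] at oy0
    have hej : j + 1 ≠ e := by
      rintro rfl
      have := dn (j + 1)
      omega
    have oy := hB.y_occ (j + 1) (hmid _ (by omega) (by omega))
    have oy' := hB.y_occ (e - 1) (hmid _ (by omega) (by omega))
    have se' := hB.y_step (e - 1) (hmid _ (by omega) (by omega))
    rw [sub_add_cancel] at se'
    rw [show cB (e - 1) = n + S - m by omega] at oy'
    rw [hj1] at oy r1 r2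
    rw [hS] at r1 r2
    have hk : P + S = m * (e - (j + 1)) := by linarith
    by_cases hk2 : 2 ≤ e - (j + 1)
    · refine (square_not_pow hX hY hm (by omega) (by omega) (by omega) (by omega) hk hk2 ?_
        oj o2 o3 oe oy oy' r2 oy0 oy1).elim
      rintro ⟨q, rfl⟩
      have q0 : 0 ≤ q := by nlinarith
      have q1 : q ≤ e - (j + 1) := by nlinarith
      obtain ⟨r3, -⟩ := hB.run hm (show j + 1 ≤ j + 1 + q by omega)
        fun k k1 k2 => hmid k (by omega) (by omega)
      refine dn (j + 1 + q) ?_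
      rw [r3, hj1]; ring
    · obtain rfl : e = j + 2 := by omega
      have hPS : P + S = m := by rw [hk]; ring
      have hc := square_centered hY hmn (by omega) (by omega) hPS oj o2 o3 oe oy oy0 oy1
      refine ⟨nA2, j, by omega, xj, hmid _ (by omega) (by omega), xe, ?_⟩
      by_contra hx
      have o := hB.y_occ _ hx
      rw [show j + 2 + 1 = j + 3 by ring] at se
      have : P = m := by
        refine hY P (by omega) ⟨2, by omega⟩ fun t t1 t2 => ?_
        rw [← o t t1 (by omega), ← oy1 (t + P) (by omega) t2]
        congr 1; omega
      omega
  · have sj := hB.x_step j xj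
    have se := hB.y_step e xe
    obtain ⟨-, r2⟩ := hB.run hm (show j + 1 ≤ e + 1 by omega) fun k k1 k2 => by
      rcases eq_or_lt_of_le (show k ≤ e by omega) with rfl | h
      · exact xe
      · exact hmid k (by omega) h
    have xj1 : ¬ xB (j + 1) := by
      rcases eq_or_lt_of_le (show j + 1 ≤ e by omega) with h | h
      · rwa [h]
      · exact hmid _ (by omega) h
    have oj := hB.x_occ j xj
    have oy := hB.y_occ _ xj1
    obtain ⟨P, hP⟩ : ∃ P, cB j = -P := ⟨-cB j, by ring⟩
    have hj1 : cB (j + 1) = n - P := by omega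
    rw [hP] at oj
    rw [hj1] at oy r2
    exact (square_not_left hX hY hm hmn (by omega) (by omega) oj o2 o3 oy
      (r2.mono le_rfl (by omega))).elim
  · have se := hB.x_step e xe
    have se' := hB.y_step (e - 1)
    obtain ⟨-, r2⟩ := hB.run hm hje.le fun k k1 k2 => by
      rcases eq_or_lt_of_le k1 with rfl | h
      · exact xj
      · exact hmid k (by omega) k2
    have xe1 : ¬ xB (e - 1) := by
      rcases eq_or_lt_of_le (show j ≤ e - 1 by omega) with h | h
      · rwa [← h]
      · exact hmid _ (by omega) (by omega)
    have oe := hB.x_occ e xe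
    have oy := hB.y_occ _ xe1
    have se' := hB.y_step _ xe1
    rw [sub_add_cancel] at se'
    obtain ⟨S, hS⟩ : ∃ S, cB e = n + S := ⟨cB e - n, by ring⟩
    have dne := dn e
    rw [show cB (e - 1) = n + S - m by omega] at oy
    rw [hS] at oe r2
    exact (square_not_right hX hY hm hmn (by omega) (by omega) o2 o3 oe oy
      (r2.mono (by omega) le_rfl)).elim
  · obtain ⟨-, r2⟩ := hB.run hm (show j ≤ e + 1 by omega) fun k k1 k2 => by
      rcases eq_or_lt_of_le k1 with rfl | h
      · exact xj
      · rcases eq_or_lt_of_le (show k ≤ e by omega) with rfl | h'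
        · exact xe
        · exact hmid k (by omega) h'
    have := hX.dvd_of_per o2 le_rfl (by omega) pn (r2.mono (a' := 0) (b' := 2 * n) (by omega)
      (by omega)) le_rfl le_rfl (by omega) hm hn
    exact (int_not_dvd this hm hmn).elim

/-- The covering of a square: if two factorizations of `f` have no cut in common, then any `xx` in
the first one is followed by `y` and is covered by `xyx` in the second one, where it sits in the
middle and `xyx` is followed by `x`. -/
lemma square_cover (hX : PrimWord X n) (hY : PrimWord Y m) (hm : 0 < m) (hmn : m < n)
    (hA : IsParse f X Y n m cA xA) (hB : IsParse f X Y n m cB xB)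
    (hd : ∀ i j, cA i ≠ cB j) {i : ℤ} (hi : xA i) (hi' : xA (i + 1)) :
    ¬ xA (i + 2) ∧
      ∃ j, 2 * (cB j - cA i) = -m ∧ xB j ∧ ¬ xB (j + 1) ∧ xB (j + 2) ∧ xB (j + 3) :=
  square_cover_zero hX hY hm hmn (hA.shift (cA i)) (hB.shift (cA i))
    (fun k l h => hd k l (by omega)) (sub_self _) hi hi'

/-- Alternating the roles of the two factorizations, the covering of squares propagates to the
right: an occurrence of `xx` continues as `xxyxx`. -/
lemma square_next (hX : PrimWord X n) (hY : PrimWord Y m) (hm : 0 < m) (hmn : m < n)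
    (hA : IsParse f X Y n m cA xA) (hB : IsParse f X Y n m cB xB)
    (hd : ∀ i j, cA i ≠ cB j) {i : ℤ} (hi : xA i) (hi' : xA (i + 1)) :
    ¬ xA (i + 2) ∧ xA (i + 3) ∧ xA (i + 4) := by
  obtain ⟨h2, j, e1, j0, j1, j2, j3⟩ := square_cover hX hY hm hmn hA hB hd hi hi'
  obtain ⟨-, k, e2, k0, k1, k2, k3⟩ := square_cover hX hY hm hmn hB hA
    (fun a b => (hd b a).symm) j2 (by rwa [add_assoc])
  have s1 := hB.x_step j j0
  have s2 := hB.y_step _ j1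
  have s3 := hA.x_step i hi
  rw [show j + 1 + 1 = j + 2 by ring] at s2
  obtain rfl : k = i + 1 := (hA.strictMono (by omega) hm).injective (by omega)
  exact ⟨h2, by rwa [show i + 1 + 2 = i + 3 by ring] at k2,
    by rwa [show i + 1 + 3 = i + 4 by ring] at k3⟩

/-- If `|y| ≤ r|x|/2` but `|x| < |y|`, then `x^r`, `r ≥ 4`, in one of two factorizations forces a
common cut. -/
lemma power_cover (hX : PrimWord X n) (hY : PrimWord Y m) (hn : 0 < n) (hnm : n < m)
    {r : ℤ} (hr : 4 ≤ r) (hmr : 2 * m ≤ r * n)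
    (hA : IsParse f X Y n m cA xA) (hB : IsParse f X Y n m cB xB)
    (hd : ∀ i j, cA i ≠ cB j) {i : ℤ} (hi : ∀ k, 0 ≤ k → k < r → xA (i + k)) : False := by
  have hm : 0 < m := by omega
  have hN : 4 * n ≤ r * n := by nlinarith
  have run : ∀ k, 0 ≤ k → k ≤ r → cA (i + k) = cA i + n * k ∧ Per f n (cA i) (cA (i + k)) := by
    intro k h1 h2
    have := hA.swap.run hn (show i ≤ i + k by omega) fun l l1 l2 => by
      have := hi (l - i) (by omega) (by omega)
      rw [add_sub_cancel] at this
      exact not_not.2 this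
    rwa [show i + k - i = k by ring] at this
  obtain ⟨er, pn⟩ := run r (by omega) le_rfl
  rw [er] at pn
  have o0 := hA.x_occ i (by simpa using hi 0 le_rfl (by omega))
  have hdr := hd (i + r)
  rw [er, mul_comm] at hdr
  rw [mul_comm n r] at pn
  generalize hNr : r * n = N at *
  obtain ⟨j, j1, j2⟩ := hB.exists_cover hn hm (cA i)
  obtain ⟨e, e1, e2⟩ := hB.exists_cover hn hm (cA i + N)
  have hmono := hB.strictMono hn hm
  have dj := hd i j
  have de := hdr e
  have hje : j < e := by
    rcases lt_trichotomy j e with h | rfl | h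
    · exact h
    · by_cases hx : xB j
      · have := hB.x_step j hx; omega
      · have := hB.y_step j hx; omega
    · have := hmono.monotone (show e + 1 ≤ j by omega); omega
  have hmid : ∀ k, j < k → k < e → ¬ xB k := by
    intro k k1 k2 hk
    have s1 := hmono.monotone (show j + 1 ≤ k by omega)
    have s2 := hmono.monotone (show k + 1 ≤ e by omega)
    have := hB.x_step k hk
    obtain ⟨q, hq⟩ := hX.dvd_sub hn pn o0 le_rfl (by omega) (hB.x_occ k hk) (by omega) (by omega)
    have q0 : 0 ≤ q := by nlinarith
    have q1 : q ≤ r := by nlinarith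
    have := (run q q0 q1).1
    exact hd (i + q) k (by omega)
  -- a run of `y` that overlaps the power of `x` in length at least `n + m` is impossible
  have key : ∀ p q, p < q → (∀ k, p ≤ k → k < q → ¬ xB k) → ∀ a b, cA i ≤ a → cB p ≤ a →
      b ≤ cA i + N → b ≤ cB q → n + m ≤ b - a → False := by
    intro p q hpq hy a b h1 h2 h3 h4 h5
    obtain ⟨-, rp⟩ := hB.run hm hpq.le hy
    have s1 := hmono.monotone (show p + 1 ≤ q by omega)
    have s2 := hB.y_step p (hy p le_rfl hpq)
    have := hY.dvd_of_per (hB.y_occ p (hy p le_rfl hpq)) le_rfl (by omega) rp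
      (pn.mono h1 h3) h2 h4 (by omega) hn hm
    exact int_not_dvd this hn hnm
  by_cases xj : xB j <;> by_cases xe : xB e
  · have sj := hB.x_step j xj
    have se := hB.x_step e xe
    obtain ⟨r1, -⟩ := hB.run hm (show j + 1 ≤ e by omega) fun k k1 k2 => hmid k (by omega) k2
    have k0 : 1 < e - (j + 1) := by nlinarith
    have : m * 2 ≤ m * (e - (j + 1)) := by nlinarith
    exact key (j + 1) e (by omega) (fun k k1 k2 => hmid k (by omega) k2) (cB (j + 1)) (cB e)
      (by omega) le_rfl (by omega) le_rfl (by omega)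
  · have sj := hB.x_step j xj
    refine key (j + 1) (e + 1) (by omega) (fun k k1 k2 => ?_) (cB (j + 1)) (cA i + N)
      (by omega) le_rfl le_rfl (by omega) (by omega)
    rcases eq_or_lt_of_le (show k ≤ e by omega) with rfl | h
    · exact xe
    · exact hmid k (by omega) h
  · have se := hB.x_step e xe
    refine key j e (by omega) (fun k k1 k2 => ?_) (cA i) (cB e)
      le_rfl (by omega) (by omega) le_rfl (by omega)
    rcases eq_or_lt_of_le k1 with rfl | h
    · exact xj
    · exact hmid k (by omega) k2
  · refine key j (e + 1) (by omega) (fun k k1 k2 => ?_) (cA i) (cA i + N)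
      le_rfl (by omega) le_rfl (by omega) (by omega)
    rcases eq_or_lt_of_le k1 with rfl | h
    · exact xj
    · rcases eq_or_lt_of_le (show k ≤ e by omega) with rfl | h'
      · exact xe
      · exact hmid k (by omega) h'

end

/-! ### Powers, primitive words, and substitutions -/

section

variable {α γ : Type*}

lemma pow_zero' (u : List γ) : pow u 0 = [] := rfl

lemma pow_succ' (u : List γ) (k : ℕ) : pow u (k + 1) = u ++ pow u k := by
  simp [pow, List.replicate_succ]

lemma pow_one' (u : List γ) : pow u 1 = u := by simp [pow]

lemma pow_add' (u : List γ) (j k : ℕ) : pow u (j + k) = pow u j ++ pow u k := by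
  induction j with
  | zero => simp [pow_zero']
  | succ j ih => rw [Nat.succ_add, pow_succ', pow_succ', ih, List.append_assoc]

lemma pow_mul' (u : List γ) (j k : ℕ) : pow u (j * k) = pow (pow u j) k := by
  induction k with
  | zero => rfl
  | succ k ih => rw [Nat.mul_succ, Nat.add_comm, pow_add', pow_succ', ih]

lemma length_pow (u : List γ) (k : ℕ) : (pow u k).length = k * u.length := by
  simp [pow]

lemma getElem?_pow (u : List γ) {k t : ℕ} (h : t < k * u.length) :
    (pow u k)[t]? = u[t % u.length]? := by
  induction k generalizing t with
  | zero => omega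
  | succ k ih =>
    rw [pow_succ']
    by_cases ht : t < u.length
    · rw [List.getElem?_append_left ht, Nat.mod_eq_of_lt ht]
    · rw [Nat.succ_mul] at h
      rw [List.getElem?_append_right (by omega), ih (by omega),
        Nat.mod_eq_sub_mod (a := t) (by omega)]

/-- The finite word `x` as a function on `ℤ`. -/
def toFun (x : List γ) : ℤ → Option γ := fun t => x[t.toNat]?

/-- The bi-infinite repetition of the word `w`. -/
def cyc (w : List γ) : ℤ → Option γ := fun t => w[(t % w.length).toNat]?

lemma cyc_periodic (w : List γ) : Function.Periodic (cyc w) w.length := by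
  intro t; simp [cyc]

lemma cyc_of_lt (w : List γ) {t : ℤ} (h0 : 0 ≤ t) (h1 : t < w.length) :
    cyc w t = toFun w t := by
  rw [cyc, toFun, Int.emod_eq_of_lt h0 h1]

lemma cyc_pow (u : List γ) {k : ℕ} (hk : 0 < k) (hu : u ≠ []) (t : ℤ) :
    cyc (pow u k) t = cyc u t := by
  have hu' : 0 < u.length := List.length_pos_iff.2 hu
  have hl : 0 < k * u.length := Nat.mul_pos hk hu'
  have h1 := Int.emod_nonneg t (b := (k * u.length : ℕ)) (by omega)
  have h2 := Int.emod_lt_of_pos t (b := (k * u.length : ℕ)) (by omega)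
  rw [cyc, cyc, length_pow, getElem?_pow u (by omega), ← Int.emod_emod_of_dvd t
    (show (u.length : ℤ) ∣ (k * u.length : ℕ) from by push_cast; exact dvd_mul_left _ _)]
  congr 1
  generalize t % ((k * u.length : ℕ) : ℤ) = r at *
  zify
  rw [Int.toNat_of_nonneg h1, Int.toNat_of_nonneg (Int.emod_nonneg _ (by omega))]

lemma cyc_pow_periodic (u : List γ) {k : ℕ} (hk : 0 < k) (hu : u ≠ []) :
    Function.Periodic (cyc (pow u k)) u.length := by
  intro t
  rw [cyc_pow u hk hu, cyc_pow u hk hu]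
  exact cyc_periodic u t

lemma cyc_rotate (w : List γ) (k : ℕ) (hw : w ≠ []) (t : ℤ) :
    cyc (w.rotate k) t = cyc w (t + k) := by
  have hw' : 0 < w.length := List.length_pos_iff.2 hw
  have h1 := Int.emod_nonneg t (b := w.length) (by omega)
  have h2 := Int.emod_lt_of_pos t (b := w.length) (by omega)
  rw [cyc, cyc, List.length_rotate, List.getElem?_rotate (by omega)]
  congr 1
  zify
  rw [Int.toNat_of_nonneg h1, Int.toNat_of_nonneg (Int.emod_nonneg _ (by omega)), Int.emod_add_emod]

lemma eq_of_cyc_eq {w w' : List γ} (hl : w.length = w'.length) (h : ∀ t, cyc w t = cyc w' t) :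
    w = w' := by
  refine List.ext_getElem? fun i => ?_
  by_cases hi : i < w.length
  · have := h i
    rw [cyc_of_lt w (by omega) (by omega), cyc_of_lt w' (by omega) (by omega)] at this
    simpa [toFun] using this
  · rw [List.getElem?_eq_none (by omega), List.getElem?_eq_none (by omega)]

/-- A word whose length is a multiple of a period is a power. -/
lemma eq_pow_of_per {x : List γ} {d : ℕ} (hd : 0 < d) (hdn : d ∣ x.length)
    (hp : Per (toFun x) d 0 x.length) : x = pow (x.take d) (x.length / d) := by
  rcases Nat.eq_zero_or_pos x.length with h0 | h0
  · rw [List.length_eq_zero_iff] at h0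
    subst h0; simp [pow]
  have hdl := Nat.le_of_dvd h0 hdn
  have hl : (x.take d).length = d := by simp [hdl]
  have hk : x.length / d * d = x.length := Nat.div_mul_cancel hdn
  refine List.ext_getElem? fun i => ?_
  by_cases hi : i < x.length
  · rw [getElem?_pow _ (by rw [hl, hk]; exact hi), hl,
      List.getElem?_take_of_lt (Nat.mod_lt _ hd)]
    have h1 := Nat.mod_add_div i d
    have := hp.natMul (by omega) (i / d) ((i % d : ℕ) : ℤ) (by omega)
      (by rw [mul_comm]; exact_mod_cast (by omega : i % d + d * (i / d) < x.length))
    simp only [toFun, Int.toNat_natCast] at this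
    rw [this]
    congr 1
    rw [mul_comm]
    have e : ((i % d : ℕ) : ℤ) + d * ((i / d : ℕ) : ℤ) = (i : ℤ) := by exact_mod_cast h1
    rw [e]; simp
  · rw [List.getElem?_eq_none (by omega), List.getElem?_eq_none (by rw [length_pow, hl, hk]; omega)]

lemma IsPrimitive.primWord {x : List γ} (hx : IsPrimitive x) : PrimWord (toFun x) x.length := by
  intro d h0 hd hp
  have hx0 : 0 < x.length := List.length_pos_iff.2 hx.1
  have hle := Int.le_of_dvd (by omega) hd
  by_contra hne
  lift d to ℕ using h0.le
  refine hx.2 ⟨x.take d, x.length / d, ?_, eq_pow_of_per (by omega) (by exact_mod_cast hd) hp⟩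
  simp only [List.length_take]; omega

lemma IsPrimitive.dvd_of_periodic {x : List γ} (hx : IsPrimitive x) {d : ℤ}
    (h : Function.Periodic (cyc x) d) : (x.length : ℤ) ∣ d :=
  hx.primWord.dvd_of_periodic (c := 0)
    (fun t h0 h1 => by rw [zero_add]; exact cyc_of_lt x h0 h1)
    (by exact_mod_cast List.length_pos_iff.2 hx.1) (cyc_periodic x) h

lemma exists_root_of_not_isPrimitive {w : List γ} (hw : w ≠ []) (h : ¬ IsPrimitive w) :
    ∃ (u : List γ) (k : ℕ), u ≠ [] ∧ 2 ≤ k ∧ w = pow u k := by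
  rw [IsPrimitive] at h
  push Not at h
  obtain ⟨u, k, hl, rfl⟩ := h hw
  refine ⟨u, k, ?_, ?_, rfl⟩
  · rintro rfl
    rw [length_pow] at hl; simp at hl
  · rw [length_pow] at hl
    by_contra hk
    obtain rfl | rfl : k = 0 ∨ k = 1 := by omega
    · simp at hl
    · simp at hl

/-- The bi-infinite repetition of an imprimitive nonempty word has a period that is a proper divisor
of the length of the word. -/
lemma exists_period_of_not_isPrimitive {w : List γ} (hw : w ≠ []) (h : ¬ IsPrimitive w) :
    ∃ s : ℤ, 0 < s ∧ 2 * s ≤ w.length ∧ s ∣ w.length ∧ Function.Periodic (cyc w) s := by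
  obtain ⟨u, k, hu, hk, rfl⟩ := exists_root_of_not_isPrimitive hw h
  have hu' : 0 < u.length := List.length_pos_iff.2 hu
  refine ⟨u.length, by omega, ?_, ?_, cyc_pow_periodic u (by omega) hu⟩
  · rw [length_pow]
    have : 2 * u.length ≤ k * u.length := Nat.mul_le_mul_right _ hk
    exact_mod_cast this
  · rw [length_pow]; push_cast; exact dvd_mul_left _ _

lemma not_isPrimitive_pow (u : List γ) {k : ℕ} (hk : 2 ≤ k) : ¬ IsPrimitive (pow u k) := by
  rintro ⟨h0, h⟩
  refine h ⟨u, k, ?_, rfl⟩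
  have : 0 < u.length := by
    rw [List.length_pos_iff]
    rintro rfl
    exact h0 (by simp [pow])
  rw [length_pow]
  nlinarith

lemma not_isPrimitive_of_periodic {w : List γ} {d : ℤ} (h0 : 0 < d) (h1 : d < w.length)
    (h : Function.Periodic (cyc w) d) : ¬ IsPrimitive w :=
  fun hw => absurd (Int.le_of_dvd h0 (hw.dvd_of_periodic h)) (by omega)

lemma IsPrimitive.rotate {w : List γ} (h : IsPrimitive w) (k : ℕ) : IsPrimitive (w.rotate k) := by
  by_contra hc
  obtain ⟨s, s0, s1, -, s2⟩ := exists_period_of_not_isPrimitive (by simpa using h.1) hc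
  have hw' : 0 < w.length := List.length_pos_iff.2 h.1
  rw [List.length_rotate] at s1
  refine not_isPrimitive_of_periodic s0 (by omega) (fun t => ?_) h
  have := s2 (t - k)
  rw [cyc_rotate w k h.1, cyc_rotate w k h.1] at this
  rw [show t - k + s + k = t + s by ring, sub_add_cancel] at this
  exact this

lemma isPrimitive_iff_of_isRotated {w w' : List γ} (h : w ~r w') :
    IsPrimitive w ↔ IsPrimitive w' := by
  constructor
  · obtain ⟨k, rfl⟩ := h
    exact fun hw => hw.rotate k
  · obtain ⟨k, rfl⟩ := h.symm
    exact fun hw => hw.rotate k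

/-- Every nonempty word is a power of a primitive word. -/
lemma exists_primitive_root {w : List γ} (hw : w ≠ []) :
    ∃ (u : List γ) (k : ℕ), IsPrimitive u ∧ 1 ≤ k ∧ w = pow u k := by
  induction h : w.length using Nat.strong_induction_on generalizing w with
  | _ N ih =>
    by_cases hp : IsPrimitive w
    · exact ⟨w, 1, hp, le_rfl, (pow_one' w).symm⟩
    · obtain ⟨u, k, hu, hk, rfl⟩ := exists_root_of_not_isPrimitive hw hp
      have hu' : 0 < u.length := List.length_pos_iff.2 hu
      obtain ⟨v, j, hv, hj, rfl⟩ := ih u.length (by rw [← h, length_pow]; nlinarith) hu rfl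
      exact ⟨v, j * k, hv, Nat.mul_pos hj (by omega), (pow_mul' v j k).symm⟩

/-- The word over `α` obtained from a word over a two-letter alphabet by substituting `x` for
`true` and `y` for `false`. -/
def ev (x y : List α) (b : List Bool) : List α := b.flatMap fun c => bif c then x else y

variable {x y : List α}

@[simp] lemma ev_nil : ev x y [] = [] := rfl

@[simp] lemma ev_cons_true (b : List Bool) : ev x y (true :: b) = x ++ ev x y b := rfl

@[simp] lemma ev_cons_false (b : List Bool) : ev x y (false :: b) = y ++ ev x y b := rfl

@[simp] lemma ev_append (b b' : List Bool) : ev x y (b ++ b') = ev x y b ++ ev x y b' :=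
  List.flatMap_append

lemma ev_rotate {b : List Bool} {k : ℕ} (hk : k ≤ b.length) :
    ev x y (b.rotate k) = (ev x y b).rotate (ev x y (b.take k)).length := by
  rw [List.rotate_eq_drop_append_take hk]
  conv_rhs => rw [← List.take_append_drop k b, ev_append]
  rw [ev_append]
  have : (b.take k ++ b.drop k).take k = b.take k := by rw [List.take_append_drop]
  rw [this, List.rotate_append_length_eq]

lemma ev_isRotated {b b' : List Bool} (h : b ~r b') : ev x y b ~r ev x y b' := by
  obtain ⟨k, hk, rfl⟩ := List.isRotated_iff_mod.1 h
  exact ⟨_, (ev_rotate hk).symm⟩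

lemma ev_map_not (b : List Bool) : ev y x (b.map not) = ev x y b := by
  induction b with
  | nil => rfl
  | cons c b ih => cases c <;> simp [ih]

lemma ev_flatMap (σ : Bool → List Bool) (b : List Bool) :
    ev x y (b.flatMap σ) = ev (ev x y (σ true)) (ev x y (σ false)) b := by
  induction b with
  | nil => rfl
  | cons c b ih => cases c <;> simp [ih]

lemma ev_replicate_true (k : ℕ) : ev x y (List.replicate k true) = pow x k := by
  induction k with
  | zero => rfl
  | succ k ih => rw [List.replicate_succ, ev_cons_true, ih, pow_succ']

lemma ev_replicate_false (k : ℕ) : ev x y (List.replicate k false) = pow y k := by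
  induction k with
  | zero => rfl
  | succ k ih => rw [List.replicate_succ, ev_cons_false, ih, pow_succ']

/-- Noncommuting words generate freely. -/
lemma ev_injective (hxy : x ++ y ≠ y ++ x) : Function.Injective (ev x y) := by
  induction h : x.length + y.length using Nat.strong_induction_on generalizing x y with
  | _ N ih =>
    wlog hl : y.length ≤ x.length generalizing x y
    · intro b b' hb
      have := this hxy.symm (by omega) (by omega)
        (show ev y x (b.map not) = ev y x (b'.map not) by rwa [ev_map_not, ev_map_not])
      exact (List.map_injective_iff.2 Bool.not_injective) this
    have hx : x ≠ [] := by rintro rfl; simp at hxy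
    have hy : y ≠ [] := by rintro rfl; simp at hxy
    have hy' := List.length_pos_iff.2 hy
    by_cases hp : y <+: x
    · -- `x = y t`: pass to the shorter pair `t, y`
      obtain ⟨t, rfl⟩ := hp
      let σ : Bool → List Bool := fun c => bif c then [false, true] else [false]
      have hσ : ∀ b, ev (y ++ t) y b = ev t y (b.flatMap σ) := by
        intro b; rw [ev_flatMap]; simp [σ]
      have hinj := ih (t.length + y.length) (by rw [List.length_append] at h; omega)
        (x := t) (y := y) (by
          intro hc
          apply hxy
          rw [List.append_assoc, hc]) rfl
      intro b b' hb
      rw [hσ, hσ] at hb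
      replace hb := hinj hb
      have hne : ∀ (b : List Bool) (r : List Bool), b.flatMap σ ≠ true :: r := by
        intro b r
        cases b with
        | nil => simp
        | cons c b => cases c <;> simp [σ]
      clear hinj
      induction b generalizing b' with
      | nil =>
        cases b' with
        | nil => rfl
        | cons c' b' => cases c' <;> simp [σ] at hb
      | cons c b ihb =>
        cases b' with
        | nil => cases c <;> simp [σ] at hb
        | cons c' b' =>
          cases c <;> cases c' <;>
            simp only [List.flatMap_cons, σ, cond_true, cond_false, List.cons_append,
              List.nil_append, List.cons.injEq, true_and] at hb
          · rw [ihb hb]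
          · exact absurd hb (hne _ _)
          · exact absurd hb.symm (hne _ _)
          · rw [ihb hb]
    · have hnp : ∀ r r' : List α, x ++ r ≠ y ++ r' := by
        intro r r' he
        refine hp (List.prefix_of_prefix_length_le (l₃ := x ++ r) ?_ (List.prefix_append _ _) hl)
        rw [he]
        exact List.prefix_append _ _
      intro b b' hb
      induction b generalizing b' with
      | nil =>
        cases b' with
        | nil => rfl
        | cons c' b' => cases c' <;> simp [hx, hy] at hb
      | cons c b ihb =>
        cases b' with
        | nil => cases c <;> simp [hx, hy] at hb
        | cons c' b' =>
          cases c <;> cases c' <;> simp only [ev_cons_true, ev_cons_false] at hb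
          · rw [ihb (List.append_cancel_left hb)]
          · exact absurd hb.symm (hnp _ _)
          · exact absurd hb (hnp _ _)
          · rw [ihb (List.append_cancel_left hb)]

end

/-! ### The factorization of a periodic word -/

section

variable {α : Type*} {x y : List α}

/-- The starting positions of the letters of the bi-infinite repetition of `b` after the
substitution of `x` and `y`. -/
def cutPos (x y : List α) (b : List Bool) : ℤ → ℤ := fun j =>
  (ev x y b).length * (j / b.length) + (ev x y (b.take (j % b.length).toNat)).length

/-- The letter number `j` of the bi-infinite repetition of `b` is `true`. -/
def letterX (b : List Bool) : ℤ → Prop := fun j => cyc b j = some true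

lemma cyc_letter {b : List Bool} (hb : b ≠ []) {j : ℤ} (h : ¬ letterX b j) :
    cyc b j = some false := by
  have hb' : 0 < b.length := List.length_pos_iff.2 hb
  have h1 := Int.emod_nonneg j (b := b.length) (by omega)
  have h2 := Int.emod_lt_of_pos j (b := b.length) (by omega)
  rw [letterX, cyc, List.getElem?_eq_getElem (by omega)] at h
  rw [cyc, List.getElem?_eq_getElem (by omega)]
  simpa using h

lemma cutPos_succ_and_occ {b : List Bool} {j : ℤ} {c : Bool} (h : cyc b j = some c) :
    cutPos x y b (j + 1) = cutPos x y b j + (ev x y [c]).length ∧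
      Occ (cyc (ev x y b)) (toFun (ev x y [c])) (ev x y [c]).length (cutPos x y b j) := by
  have hb' : 0 < b.length := List.length_pos_iff.2 (by rintro rfl; simp [cyc] at h)
  have h1 := Int.emod_nonneg j (b := b.length) (by omega)
  have h2 := Int.emod_lt_of_pos j (b := b.length) (by omega)
  have h3 := Int.emod_add_mul_ediv j b.length
  rw [cyc] at h
  have hr : (j % b.length).toNat < b.length := by omega
  have hsplit : b = b.take (j % b.length).toNat ++ ([c] ++ b.drop ((j % b.length).toNat + 1)) := by
    rw [List.getElem?_eq_getElem hr, Option.some_inj] at h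
    rw [← h, List.singleton_append, ← List.drop_eq_getElem_cons hr, List.take_append_drop]
  have htake : b.take ((j % b.length).toNat + 1) = b.take (j % b.length).toNat ++ [c] := by
    rw [List.take_add_one, h]; rfl
  constructor
  · by_cases hw : j % b.length + 1 < b.length
    · have e1 : (j + 1) / b.length = j / b.length := by
        rw [Int.ediv_eq_iff_of_pos (by omega)]
        constructor <;> nlinarith
      have e2 : (j + 1) % b.length = j % b.length + 1 := by
        have := Int.emod_add_mul_ediv (j + 1) b.length
        rw [e1] at this; omega
      rw [cutPos, cutPos, e1, e2, show (j % (b.length : ℤ) + 1).toNat = (j % b.length).toNat + 1 by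
        omega, htake, ev_append, List.length_append]
      push_cast; ring
    · have e1 : (j + 1) / b.length = j / b.length + 1 := by
        rw [Int.ediv_eq_iff_of_pos (by omega)]
        constructor <;> nlinarith
      have e2 : (j + 1) % b.length = 0 := by
        have := Int.emod_add_mul_ediv (j + 1) b.length
        rw [e1] at this; nlinarith
      have e3 : b.take ((j % b.length).toNat + 1) = b := List.take_of_length_le (by omega)
      rw [cutPos, cutPos, e1, e2]
      rw [e3] at htake
      have := congrArg (fun l => ((ev x y l).length : ℤ)) htake
      simp only [ev_append, List.length_append] at this
      push_cast at this
      simp only [Int.toNat_zero, List.take_zero, ev_nil, List.length_nil]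
      push_cast
      linarith
  · intro t t0 t1
    have hev := congrArg (ev x y) hsplit
    rw [ev_append, ev_append] at hev
    rw [cutPos, add_assoc, add_comm]
    have hp := periodic_of_dvd (cyc_periodic (ev x y b)) (Dvd.intro (j / b.length) rfl)
    rw [hp]
    have hlen := congrArg List.length hev
    simp only [List.length_append] at hlen
    rw [cyc_of_lt _ (by omega) (by omega), toFun, toFun, hev,
      List.getElem?_append_right (by omega), List.getElem?_append_left (by omega)]
    congr 1; omega

lemma isParse_cyc {b : List Bool} (hb : b ≠ []) :
    IsParse (cyc (ev x y b)) (toFun x) (toFun y) x.length y.length (cutPos x y b) (letterX b) where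
  x_step j hj := by simpa using (cutPos_succ_and_occ (x := x) (y := y) hj).1
  y_step j hj := by simpa using (cutPos_succ_and_occ (x := x) (y := y) (cyc_letter hb hj)).1
  x_occ j hj := by simpa using (cutPos_succ_and_occ (x := x) (y := y) hj).2
  y_occ j hj := by simpa using (cutPos_succ_and_occ (x := x) (y := y) (cyc_letter hb hj)).2

lemma IsParse.translate {β : Type*} {f X Y : ℤ → β} {n m : ℤ} {cut : ℤ → ℤ} {isX : ℤ → Prop}
    (h : IsParse f X Y n m cut isX) {s : ℤ} (hs : Function.Periodic f s) :
    IsParse f X Y n m (fun j => cut j + s) isX where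
  x_step j hj := by rw [h.x_step j hj]; ring
  y_step j hj := by rw [h.y_step j hj]; ring
  x_occ j hj t h1 h2 := by
    rw [← h.x_occ j hj t h1 h2, ← hs (cut j + t)]; exact congrArg f (by ring)
  y_occ j hj t h1 h2 := by
    rw [← h.y_occ j hj t h1 h2, ← hs (cut j + t)]; exact congrArg f (by ring)

lemma ev_ne_nil {b : List Bool} (hb : b ≠ []) (hx : x ≠ []) (hy : y ≠ []) : ev x y b ≠ [] := by
  cases b with
  | nil => exact absurd rfl hb
  | cons c b => cases c <;> simp [hx, hy]

/-- Moving the origin to a cut amounts to rotating the list. -/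
lemma cyc_ev_rotate {b : List Bool} (hb : b ≠ []) (hx : x ≠ []) (hy : y ≠ []) (i t : ℤ) :
    cyc (ev x y (b.rotate (i % b.length).toNat)) t = cyc (ev x y b) (t + cutPos x y b i) := by
  have hb' : 0 < b.length := List.length_pos_iff.2 hb
  have h2 := Int.emod_lt_of_pos i (b := b.length) (by omega)
  rw [ev_rotate (by omega), cyc_rotate _ _ (ev_ne_nil hb hx hy), cutPos, add_comm (_ * _ : ℤ),
    ← add_assoc, periodic_of_dvd (cyc_periodic (ev x y b)) (Dvd.intro (i / b.length) rfl)]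

/-- If the repetition of the image of a primitive list has a period that is shorter than the
image, then the factorization into letters and its translate by this period have no cut in
common. -/
lemma cutPos_ne (hxy : x ++ y ≠ y ++ x) {b : List Bool} (hb : IsPrimitive b) {s : ℤ}
    (hs0 : 0 < s) (hs1 : s < (ev x y b).length) (hs : Function.Periodic (cyc (ev x y b)) s)
    (i j : ℤ) : cutPos x y b i ≠ cutPos x y b j + s := by
  intro h
  have hx : x ≠ [] := by rintro rfl; simp at hxy
  have hy : y ≠ [] := by rintro rfl; simp at hxy
  have hb' : 0 < b.length := List.length_pos_iff.2 hb.1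
  have e : b.rotate (i % b.length).toNat = b.rotate (j % b.length).toNat := by
    refine ev_injective hxy (eq_of_cyc_eq ?_ fun t => ?_)
    · have h1 := Int.emod_lt_of_pos i (b := b.length) (by omega)
      have h2 := Int.emod_lt_of_pos j (b := b.length) (by omega)
      rw [ev_rotate (by omega), ev_rotate (by omega), List.length_rotate, List.length_rotate]
    · rw [cyc_ev_rotate hb.1 hx hy, cyc_ev_rotate hb.1 hx hy, h, ← add_assoc, hs]
  have hp : Function.Periodic (cyc b) (i - j) := by
    have key : ∀ k t : ℤ, cyc (b.rotate (k % b.length).toNat) t = cyc b (t + k) := by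
      intro k t
      have h1 := Int.emod_nonneg k (b := b.length) (by omega)
      rw [cyc_rotate _ _ hb.1, Int.toNat_of_nonneg h1,
        ← periodic_of_dvd (cyc_periodic b) (Dvd.intro (k / b.length) rfl) (t + _), add_assoc,
        Int.emod_add_mul_ediv]
    intro t
    have e1 := key i (t - j)
    have e2 := key j (t - j)
    rw [e, e2] at e1
    rw [sub_add_cancel] at e1
    rw [e1]; congr 1; ring
  obtain ⟨q, hq⟩ := hb.dvd_of_periodic hp
  have e1 : cutPos x y b i = cutPos x y b j + (ev x y b).length * q := by
    obtain rfl : i = j + b.length * q := by linarith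
    rw [cutPos, cutPos, Int.add_mul_emod_self_left, Int.add_mul_ediv_left _ _ (by omega)]
    ring
  rw [e1] at h
  have h3 : s = (ev x y b).length * q := by omega
  exact int_not_dvd (Dvd.intro q h3.symm) hs0 hs1

end

/-! ### Lists of primitive words -/

section

variable {α : Type*} {x y : List α}

/-- A primitive list that continues as `xxyxxyxxy⋯` from some position on is a conjugate of
`xxy`. -/
lemma isRotated_of_letterX {b : List Bool} (hb : IsPrimitive b) {i : ℤ} (hi : letterX b i)
    (hi' : letterX b (i + 1)) (hstep : ∀ i, letterX b i → letterX b (i + 1) →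
      ¬ letterX b (i + 2) ∧ letterX b (i + 3) ∧ letterX b (i + 4)) :
    b ~r [true, true, false] := by
  have hb' : 0 < b.length := List.length_pos_iff.2 hb.1
  have hi0 := Int.emod_nonneg i (b := b.length) (by omega)
  have hW : ∀ k t : ℤ, cyc b (t + b.length * k) = cyc b t :=
    fun k t => periodic_of_dvd (cyc_periodic b) (Dvd.intro k rfl) t
  have key : ∀ k : ℕ, letterX b (i + 3 * k) ∧ letterX b (i + 3 * k + 1) := by
    intro k
    induction k with
    | zero => simpa using ⟨hi, hi'⟩
    | succ k ih =>
      obtain ⟨-, h3, h4⟩ := hstep _ ih.1 ih.2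
      push_cast
      exact ⟨by rwa [show i + 3 * ((k : ℤ) + 1) = i + 3 * k + 3 by ring],
        by rwa [show i + 3 * ((k : ℤ) + 1) + 1 = i + 3 * k + 4 by ring]⟩
  have v0 : ∀ k : ℕ, cyc b (i + 3 * k) = some true := fun k => (key k).1
  have v1 : ∀ k : ℕ, cyc b (i + 3 * k + 1) = some true := fun k => (key k).2
  have v2 : ∀ k : ℕ, cyc b (i + 3 * k + 2) = some false :=
    fun k => cyc_letter hb.1 (hstep _ (key k).1 (key k).2).1
  have p3 : Function.Periodic (cyc b) 3 := by
    intro t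
    obtain ⟨k, r, hk, hr0, hr3⟩ : ∃ (k : ℕ) (r : ℤ),
        t + b.length * |i - t| = i + 3 * k + r ∧ 0 ≤ r ∧ r < 3 := by
      have h0 : i - t ≤ b.length * |i - t| := by
        have := le_abs_self (i - t)
        have := abs_nonneg (i - t)
        nlinarith
      refine ⟨((t + b.length * |i - t| - i) / 3).toNat, (t + b.length * |i - t| - i) % 3,
        ?_, ?_, ?_⟩
      all_goals omega
    have hk' : t + 3 + b.length * |i - t| = i + 3 * (k + 1 : ℕ) + r := by push_cast; omega
    rw [← hW |i - t| t, ← hW |i - t| (t + 3), hk, hk']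
    obtain rfl | rfl | rfl : r = 0 ∨ r = 1 ∨ r = 2 := by omega
    · rw [add_zero, add_zero, v0, v0]
    · rw [v1, v1]
    · rw [v2, v2]
  have hd := hb.dvd_of_periodic p3
  have h03 := v0 0
  have h13 := v1 0
  have h23 := v2 0
  have hle := Int.le_of_dvd (by norm_num) hd
  obtain hl | hl | hl : b.length = 1 ∨ b.length = 2 ∨ b.length = 3 := by omega
  · have := hW 1 (i + 3 * (0 : ℕ) + 1)
    rw [hl, h13] at this
    simp only [Nat.cast_one, mul_one] at this
    rw [add_assoc, show (1 : ℤ) + 1 = 2 by norm_num, h23] at this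
    simp at this
  · rw [hl] at hd; norm_num at hd
  · refine ⟨(i % b.length).toNat, ?_⟩
    have hrot : ∀ t, cyc (b.rotate (i % b.length).toNat) t = cyc b (t + i) := by
      intro t
      rw [cyc_rotate _ _ hb.1, Int.toNat_of_nonneg hi0, ← hW (i / b.length) (t + _), add_assoc,
        Int.emod_add_mul_ediv]
    refine eq_of_cyc_eq (by rw [List.length_rotate, hl]; rfl) fun t => ?_
    have hr0 := Int.emod_nonneg t (b := 3) (by norm_num)
    have hr3 := Int.emod_lt_of_pos t (b := 3) (by norm_num)
    rw [hrot, ← Int.emod_add_mul_ediv t 3]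
    have e1 := periodic_of_dvd p3 (Dvd.intro (t / 3) rfl) (t % 3 + i)
    have e2 := periodic_of_dvd (cyc_periodic [true, true, false])
      (Dvd.intro (t / 3) rfl) (t % 3)
    simp only [List.length_cons, List.length_nil] at e2
    rw [show t % 3 + 3 * (t / 3) + i = t % 3 + i + 3 * (t / 3) by ring, e1]
    refine Eq.trans ?_ e2.symm
    simp only [Nat.cast_zero, mul_zero, add_zero] at h03 h13 h23
    obtain hr | hr | hr : t % 3 = 0 ∨ t % 3 = 1 ∨ t % 3 = 2 := by omega
    · rw [hr, zero_add, h03]; rfl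
    · rw [hr, add_comm, h13]; rfl
    · rw [hr, add_comm, h23]; rfl

/-- Let `|x| = |y|`, both primitive. If a primitive list contains `xx` cyclically, then its
concatenation is primitive. -/
lemma equal_length_no_square {b : List Bool} (hb : IsPrimitive b) (hx : IsPrimitive x)
    (hy : IsPrimitive y) (hxy : x ++ y ≠ y ++ x) (hl : x.length = y.length) {i : ℤ}
    (hi : letterX b i) (hi' : letterX b (i + 1)) : IsPrimitive (ev x y b) := by
  by_contra hw
  have hb' : 0 < b.length := List.length_pos_iff.2 hb.1
  have hN := ev_ne_nil hb.1 hx.1 hy.1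
  have hN' : 0 < (ev x y b).length := List.length_pos_iff.2 hN
  have hn : 0 < x.length := List.length_pos_iff.2 hx.1
  obtain ⟨s, s0, s1, -, hs⟩ := exists_period_of_not_isPrimitive hN hw
  have hd := cutPos_ne hxy hb s0 (by omega) hs
  have hA := isParse_cyc (x := x) (y := y) hb.1
  have pX := hx.primWord
  have pY := hy.primWord
  rw [← hl] at hA pY
  generalize toFun x = X at *
  generalize toFun y = Y at *
  generalize hf : cyc (ev x y b) = f at *
  generalize cutPos x y b = cut at *
  generalize hnn : (x.length : ℤ) = n at *
  have hn : 0 < n := by omega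
  have step : ∀ j, cut (j + 1) = cut j + n := fun j => by
    by_cases h : letterX b j
    · exact hA.x_step j h
    · exact hA.y_step j h
  have hcut : ∀ j k : ℤ, cut (j + k) = cut j + n * k := by
    intro j k
    induction k using Int.induction_on with
    | zero => simp
    | succ k ih => rw [← add_assoc, step, ih]; ring
    | pred k ih =>
      have := step (j + (-k - 1))
      rw [show j + (-(k : ℤ) - 1) + 1 = j + -k by ring, ih] at this
      linarith
  -- every position that is congruent to a cut modulo `g = gcd(s, n)` carries a letter
  have hall : ∀ p, (Int.gcd s n : ℤ) ∣ p - cut i → Occ f X n p ∨ Occ f Y n p := by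
    rintro p ⟨q, hq⟩
    rw [Int.gcd_eq_gcd_ab] at hq
    have hB := hA.translate (periodic_of_dvd hs (Dvd.intro (Int.gcdA s n * q) rfl))
    have e : cut (i + Int.gcdB s n * q) + s * (Int.gcdA s n * q) = p := by rw [hcut]; linarith
    by_cases h : letterX b (i + Int.gcdB s n * q)
    · left; rw [← e]; exact hB.x_occ _ h
    · right; rw [← e]; exact hB.y_occ _ h
  have gpos : 0 < (Int.gcd s n : ℤ) := by exact_mod_cast Int.gcd_pos_of_ne_zero_left _ s0.ne'
  have gs := Int.gcd_dvd_left s n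
  have gn := Int.gcd_dvd_right s n
  generalize (Int.gcd s n : ℤ) = g at *
  have gln : g < n := by
    refine lt_of_le_of_ne (Int.le_of_dvd hn gn) ?_
    rintro rfl
    obtain ⟨q, rfl⟩ := gs
    exact hd (i + q) i (hcut i q)
  have pXg : ¬ Per X g 0 n := fun h => by have := pX g gpos gn h; omega
  have pYg : ¬ Per Y g 0 n := fun h => by have := pY g gpos gn h; omega
  have oin : ∀ p, g ∣ p - cut i → Occ f X n p → Occ f X n (p + n) → ∀ k, 0 < k → k * g < n →
      Occ f Y n (p + k * g) := by
    intro p hp h1 h2 k hk hk2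
    refine (hall (p + k * g) ?_).resolve_left fun h => ?_
    · rw [show p + k * g - cut i = p - cut i + k * g by ring]
      exact dvd_add hp (dvd_mul_left _ _)
    · have : 0 < k * g := by positivity
      exact pX.no_inner h1 h2 h (by omega) (by omega)
  have o1 := hA.x_occ i hi
  have o2 := hA.x_occ (i + 1) hi'
  rw [step] at o2
  have y1 := oin _ (by simp) o1 o2 1 one_pos (by omega)
  by_cases h2g : 2 * g < n
  · have y2 := oin _ (by simp) o1 o2 2 two_pos h2g
    have q1 := y1.per y2
    have q2 := o1.per o2
    have := pX.dvd_of_per o1 le_rfl (by omega : _ ≤ cut i + 2 * n)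
      (by rwa [add_sub_cancel_left, add_assoc, ← two_mul] at q2) (d := g)
      (a' := cut i + g) (b' := cut i + 2 * g + n)
      (by rwa [show cut i + 2 * g - (cut i + 1 * g) = g by ring, one_mul] at q1)
      (by omega) (by omega) (by omega) gpos hn
    exact int_not_dvd this gpos gln
  · obtain rfl : n = 2 * g := by
      obtain ⟨k, rfl⟩ := gn
      have : k = 2 := by
        have : 1 < k := by nlinarith
        have : k < 3 := by nlinarith
        omega
      rw [this, mul_comm]
    have next : ∀ j, letterX b j → letterX b (j + 1) → letterX b (j + 2) := by
      intro j hj hj'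
      by_contra hc
      have e0 : 2 * g ∣ cut j - cut i := ⟨j - i, by
        have := hcut i (j - i)
        rw [add_sub_cancel] at this
        linarith⟩
      have o1 := hA.x_occ j hj
      have o2 := hA.x_occ _ hj'
      have o3 := hA.y_occ _ hc
      rw [hcut] at o2 o3
      rw [mul_one] at o2
      have y4 : Occ f Y (2 * g) (cut j + 2 * g + g) := by
        refine (hall _ ?_).resolve_left fun h => pXg fun t t1 t2 => ?_
        · rw [show cut j + 2 * g + g - cut i = cut j - cut i + g * 3 by ring]
          exact dvd_add ((dvd_mul_left _ _).trans e0) (dvd_mul_right _ _)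
        · rw [← h t t1 (by omega), ← o2 (t + g) (by omega) t2]
          exact congrArg f (by ring)
      refine pYg fun t t1 t2 => ?_
      rw [← o3 t t1 (by omega), ← y4 (t + g) (by omega) t2]
      exact congrArg f (by ring)
    have all : ∀ k : ℕ, letterX b (i + k) ∧ letterX b (i + k + 1) := by
      intro k
      induction k with
      | zero => simpa using ⟨hi, hi'⟩
      | succ k ih =>
        push_cast
        rw [← add_assoc]
        exact ⟨ih.2, by simpa [add_assoc] using next _ ih.1 ih.2⟩
    have all' : ∀ t, cyc b t = some true := by
      intro t
      have h0 : i ≤ t + b.length * |i - t| := by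
        have := le_abs_self (i - t)
        have := abs_nonneg (i - t)
        nlinarith
      have := (all (t + b.length * |i - t| - i).toNat).1
      rw [Int.toNat_of_nonneg (by omega), letterX, add_sub_cancel,
        periodic_of_dvd (cyc_periodic b) (Dvd.intro _ rfl)] at this
      exact this
    have := hb.dvd_of_periodic (d := 1) fun t => by rw [all', all']
    have hb1 : b = [true] := by
      refine eq_of_cyc_eq ?_ fun t => ?_
      · have := Int.le_of_dvd one_pos this
        simp only [List.length_singleton]; omega
      · rw [all', cyc]; simp
    rw [hb1] at hw
    simp only [ev_cons_true, ev_nil, List.append_nil] at hw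
    exact hw hx

/-- The case of primitive words: if a primitive list containing the factor `xx` cyclically has an
imprimitive concatenation, then it is a conjugate of `xxy`. -/
lemma isRotated_of_primitive {b : List Bool} (hb : IsPrimitive b) (hx : IsPrimitive x)
    (hy : IsPrimitive y) (hxy : x ++ y ≠ y ++ x) (hl : y.length ≤ x.length) {i : ℤ}
    (hi : letterX b i) (hi' : letterX b (i + 1)) (hw : ¬ IsPrimitive (ev x y b)) :
    b ~r [true, true, false] := by
  rcases eq_or_lt_of_le hl with h | h
  · exact absurd (equal_length_no_square hb hx hy hxy h.symm hi hi') hw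
  · have hN := ev_ne_nil hb.1 hx.1 hy.1
    have hN' : 0 < (ev x y b).length := List.length_pos_iff.2 hN
    have hm : 0 < y.length := List.length_pos_iff.2 hy.1
    obtain ⟨s, s0, s1, -, hs⟩ := exists_period_of_not_isPrimitive hN hw
    have hA := isParse_cyc (x := x) (y := y) hb.1
    exact isRotated_of_letterX hb hi hi' fun j h1 h2 =>
      square_next hx.primWord hy.primWord (by omega) (by omega) hA (hA.translate hs)
        (cutPos_ne hxy hb s0 (by omega) hs) h1 h2

end

/-! ### Commuting words and blocks -/

section

variable {α : Type*} {x y : List α}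

lemma ev_ev (p q b : List Bool) : ev x y (ev p q b) = ev (ev x y p) (ev x y q) b :=
  ev_flatMap (fun c => bif c then p else q) b

lemma ev_pow (u : List Bool) (k : ℕ) : ev x y (pow u k) = pow (ev x y u) k := by
  induction k with
  | zero => rfl
  | succ k ih => rw [pow_succ', pow_succ', ev_append, ih]

lemma append_pow_comm {u v : List α} (h : u ++ v = v ++ u) (k : ℕ) :
    u ++ pow v k = pow v k ++ u := by
  induction k with
  | zero => simp [pow_zero']
  | succ k ih => rw [pow_succ', ← List.append_assoc, h, List.append_assoc, ih, List.append_assoc]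

lemma pow_append_pow_comm {u v : List α} (h : u ++ v = v ++ u) (j k : ℕ) :
    pow u j ++ pow v k = pow v k ++ pow u j :=
  append_pow_comm (append_pow_comm h.symm j).symm k

lemma occ_cyc (p q : List α) : Occ (cyc (p ++ x ++ q)) (toFun x) x.length p.length := by
  intro t h0 h1
  rw [cyc_of_lt _ (by omega) (by simp; omega), toFun, toFun, List.append_assoc,
    List.getElem?_append_right (by omega), List.getElem?_append_left (by omega)]
  congr 1; omega

/-- Two words commute if they occur in phase in a function having both lengths as periods. -/
lemma comm_of_periodic {F : ℤ → Option α} {a b : ℤ} (hx : Function.Periodic F x.length)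
    (hy : Function.Periodic F y.length) (ha : Occ F (toFun x) x.length a)
    (hb : Occ F (toFun y) y.length b) (hab : Function.Periodic F (b - a)) :
    x ++ y = y ++ x := by
  have hb' : Occ F (toFun y) y.length a := by
    intro t h0 h1
    rw [← hb t h0 h1, ← hab]; exact congrArg F (by ring)
  have key : ∀ {x y : List α}, Function.Periodic F x.length → Occ F (toFun x) x.length a →
      Occ F (toFun y) y.length a → ∀ t : ℕ, t < x.length + y.length →
      (x ++ y)[t]? = F (a + t) := by
    intro x y hx ha hb t ht
    by_cases h : t < x.length
    · rw [List.getElem?_append_left h, ha t (by omega) (by omega)]; rfl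
    · rw [List.getElem?_append_right (by omega)]
      have := hb (t - x.length) (by omega) (by omega)
      rw [← hx, show a + (t - (x.length : ℤ)) + x.length = a + t by ring] at this
      rw [this, toFun]
      congr 1; omega
  refine List.ext_getElem? fun t => ?_
  by_cases h : t < x.length + y.length
  · rw [key hx ha hb' t h, key hy hb' ha t (by omega)]
  · rw [List.getElem?_eq_none (by simp; omega), List.getElem?_eq_none (by simp; omega)]

/-- The word `xyxyy` is primitive. -/
lemma isPrimitive_ev_two_blocks (hxy : x ++ y ≠ y ++ x) :
    IsPrimitive (ev (x ++ y) y [true, true, false]) := by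
  have hx : x ≠ [] := by rintro rfl; simp at hxy
  have hy : y ≠ [] := by rintro rfl; simp at hxy
  have hr : ev (x ++ y) y [true, true, false] ~r ev (x ++ y) y [false, true, true] :=
    ev_isRotated ⟨2, rfl⟩
  rw [isPrimitive_iff_of_isRotated hr]
  by_contra hw
  obtain ⟨s, s0, s1, -, hs⟩ := exists_period_of_not_isPrimitive
    (ev_ne_nil (by simp) (by simp [hx]) hy) hw
  have o1 := occ_cyc (x := y ++ x ++ y) [] (x ++ y)
  have o2 := occ_cyc (x := y ++ x ++ y) (y ++ x) []
  have hN := cyc_periodic (ev (x ++ y) y [false, true, true])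
  have oy := occ_cyc (x := y) [] (x ++ y ++ x ++ y)
  have ox := occ_cyc (x := x) y (y ++ x ++ y)
  have e : ev (x ++ y) y [false, true, true] = y ++ x ++ y ++ x ++ y := by simp
  rw [e] at hs s1 hN
  simp only [List.append_assoc, List.nil_append, List.append_nil, List.length_append,
    List.length_nil] at *
  push_cast at *
  generalize cyc _ = F at *
  have p1 := o1.per o2
  have q1 : Function.Periodic F (y.length + x.length : ℤ) :=
    periodic_of_window hs s0 (by simpa using p1) (by omega)
  have q2 : Function.Periodic F (y.length : ℤ) := by
    have := (hN.sub_period q1).sub_period q1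
    rwa [show (y.length : ℤ) + (x.length + (y.length + (x.length + y.length))) -
      (y.length + x.length) - (y.length + x.length) = y.length by ring] at this
  have q3 : Function.Periodic F (x.length : ℤ) := by
    have := q1.sub_period q2
    rwa [add_sub_cancel_left] at this
  exact hxy (comm_of_periodic q3 q2 ox oy (by simpa using q2.neg))

/-- In a list over the blocks `true^i` and `false^j`, a change from `false` to `true` happens only
between blocks. -/
lemma split_of_ev_replicate {i j : ℕ} {b : List Bool} :
    ∀ {p q : List Bool}, (p = [] ∨ ∃ p', p = p' ++ [false]) → (∃ q', q = true :: q') →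
      p ++ q = ev (List.replicate i true) (List.replicate j false) b →
      ∃ b₁ , p = ev (List.replicate i true) (List.replicate j false) b₁ := by
  induction b with
  | nil =>
    rintro p q - ⟨q', rfl⟩ h
    simp at h
  | cons c b ih =>
    rintro p q hp ⟨q', rfl⟩ h
    rcases hp with rfl | ⟨p', rfl⟩
    · exact ⟨[], rfl⟩
    have main : ∀ (A : List Bool), A = ev (List.replicate i true) (List.replicate j false) [c] →
        p' ++ [false] ++ true :: q' =
          A ++ ev (List.replicate i true) (List.replicate j false) b →
        ∃ b₁, p' ++ [false] = ev (List.replicate i true) (List.replicate j false) b₁ := by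
      intro A hA h
      rcases List.append_eq_append_iff.1 h with ⟨a', ha, hq⟩ | ⟨c', hc, hE⟩
      · have hA' : A = p' ++ [false] ++ a' := ha
        have hmem : ∀ d ∈ A, d = c := by
          rw [hA]; intro d hd
          cases c <;> simp at hd <;> exact hd.2
        obtain rfl : false = c := hmem false (by rw [hA']; simp)
        cases a' with
        | nil => exact ⟨[false], by rw [← hA, hA', List.append_nil]⟩
        | cons d a' =>
          have := hmem d (by rw [hA']; simp)
          rw [List.cons_append] at hq
          simp [this] at hq
      · have : c' = [] ∨ ∃ p'', c' = p'' ++ [false] := by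
          rcases List.eq_nil_or_concat c' with h | ⟨p'', d, rfl⟩
          · exact Or.inl h
          · right
            refine ⟨p'', ?_⟩
            rw [List.concat_eq_append, ← List.append_assoc] at hc
            have := List.append_inj_right' hc rfl
            simp at this
            rw [this]; simp
        obtain ⟨b₁, hb₁⟩ := ih this ⟨q', rfl⟩ hE.symm
        refine ⟨c :: b₁, ?_⟩
        rw [hc, hb₁, hA, ← List.singleton_append (l := b₁), ev_append]
    refine main _ rfl ?_
    rw [h, ← List.singleton_append (l := b), ev_append]

lemma exists_last_false {l : List Bool} (h : false ∈ l) :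
    ∃ r k, l = r ++ false :: List.replicate k true := by
  induction l with
  | nil => simp at h
  | cons c l ih =>
    by_cases hl : false ∈ l
    · obtain ⟨r, k, rfl⟩ := ih hl
      exact ⟨c :: r, k, rfl⟩
    · obtain rfl : false = c := by simpa [hl] using h
      refine ⟨[], l.length, ?_⟩
      rw [List.nil_append, ← List.eq_replicate_of_mem (a := true)]
      intro d hd
      cases d
      · exact absurd hd hl
      · rfl

/-- A list containing both letters has a rotation that starts with `true` and ends with
`false`. -/
lemma exists_rotation_true_false {b : List Bool} (h1 : true ∈ b) (h2 : false ∈ b) :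
    ∃ r, b ~r true :: (r ++ [false]) := by
  obtain ⟨p, q, rfl⟩ := List.append_of_mem h1
  have h3 : false ∈ q ++ p := by simpa [or_comm] using h2
  obtain ⟨r, k, hr⟩ := exists_last_false h3
  refine ⟨List.replicate k true ++ r, ?_⟩
  have e1 : p ++ true :: q ~r true :: (r ++ false :: List.replicate k true) := by
    rw [← hr]; exact List.isRotated_append
  have e2 : (true :: (r ++ [false])) ++ List.replicate k true ~r
      List.replicate k true ++ (true :: (r ++ [false])) := List.isRotated_append
  have e3 : List.replicate k true ++ (true :: (r ++ [false])) =
      true :: (List.replicate k true ++ r ++ [false]) := by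
    have : ∀ (k : ℕ) (l : List Bool),
        List.replicate k true ++ true :: l = true :: (List.replicate k true ++ l) := by
      intro k l
      induction k with
      | zero => rfl
      | succ k ih => simp [List.replicate_succ, ih]
    rw [this, List.append_assoc]
  rw [← e3]
  refine e1.trans ?_
  simpa using e2

/-- Replacing the letters by powers of them preserves primitivity. -/
lemma isPrimitive_ev_replicate {i j : ℕ} (hi : 1 ≤ i) (hj : 1 ≤ j) {b : List Bool}
    (hb : IsPrimitive b) (h1 : true ∈ b) (h2 : false ∈ b) :
    IsPrimitive (ev (List.replicate i true) (List.replicate j false) b) := by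
  obtain ⟨r, hr⟩ := exists_rotation_true_false h1 h2
  rw [isPrimitive_iff_of_isRotated hr] at hb
  rw [isPrimitive_iff_of_isRotated (ev_isRotated hr)]
  by_contra hw
  obtain ⟨i, rfl⟩ := Nat.exists_eq_succ_of_ne_zero (show i ≠ 0 by omega)
  obtain ⟨j, rfl⟩ := Nat.exists_eq_succ_of_ne_zero (show j ≠ 0 by omega)
  obtain ⟨t, k, ht, hk, he⟩ := exists_root_of_not_isPrimitive
    (ev_ne_nil hb.1 (by simp) (by simp)) hw
  obtain ⟨k, rfl⟩ : ∃ k', k = k' + 2 := ⟨k - 2, by omega⟩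
  have t1 : ∃ t', t = true :: t' := by
    cases t with
    | nil => exact absurd rfl ht
    | cons c t =>
      rw [pow_succ', ev_cons_true, List.replicate_succ, List.cons_append, List.cons_append] at he
      exact ⟨t, by rw [(List.cons_eq_cons.1 he).1]⟩
  have t2 : ∃ t', t = t' ++ [false] := by
    rcases List.eq_nil_or_concat t with h | ⟨t', d, rfl⟩
    · exact absurd h ht
    · refine ⟨t', ?_⟩
      rw [pow_add' _ (k + 1) 1, pow_one', ← List.cons_append, ev_append, ev_cons_false, ev_nil,
        List.append_nil, List.concat_eq_append] at he
      have := congrArg List.getLast? he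
      simp [List.getLast?_append, List.getLast?_replicate] at this
      rw [← this]; simp
  obtain ⟨b₁, hb₁⟩ := split_of_ev_replicate (i := i + 1) (j := j + 1)
    (p := t) (q := pow t (k + 1)) (Or.inr t2)
    (by obtain ⟨t', ht'⟩ := t1; exact ⟨t' ++ pow t k, by rw [pow_succ']; nth_rw 1 [ht']; rfl⟩)
    (by rw [← pow_succ']; exact he.symm)
  rw [hb₁, ← ev_pow] at he
  have := ev_injective (by simp [List.replicate_succ]) he
  rw [this] at hb
  exact not_isPrimitive_pow _ (by omega) hb

/-- A list of letters in which `true` is never followed cyclically by `true` is a list over the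
blocks `[true, false]` and `[false]`. -/
lemma exists_blocks : ∀ l : List Bool,
    List.IsChain (fun a b => a = false ∨ b = false) (l ++ [true]) →
    ∃ c, l = ev [true, false] [false] c
  | [], _ => ⟨[], rfl⟩
  | false :: l, h => by
    obtain ⟨c, hc⟩ := exists_blocks l (h.of_cons)
    exact ⟨false :: c, by rw [ev_cons_false, ← hc]; rfl⟩
  | [true], h => by simp at h
  | true :: true :: l, h => by simp at h
  | true :: false :: l, h => by
    obtain ⟨c, hc⟩ := exists_blocks l (h.of_cons.of_cons)
    exact ⟨true :: c, by rw [ev_cons_true, ← hc]; rfl⟩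

end

/-! ### Lists with two or more letters `x` -/

section

variable {α : Type*} {x y : List α}

lemma letterX_rotate {b : List Bool} (hb : b ≠ []) (k : ℕ) (i : ℤ) :
    letterX (b.rotate k) i ↔ letterX b (i + k) := by
  rw [letterX, letterX, cyc_rotate _ _ hb]

lemma mem_false_of_count {b : List Bool} (hb : IsPrimitive b) (hc : 2 ≤ b.count true) :
    false ∈ b := by
  by_contra h
  have : b = pow [true] b.length := by
    rw [pow, List.flatten_replicate_singleton]
    refine List.eq_replicate_of_mem fun c hcb => ?_
    cases c
    · exact absurd hcb h
    · rfl
  have h2 := List.count_le_length (a := true) (l := b)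
  rw [this] at hb
  exact not_isPrimitive_pow _ (by omega) hb

lemma count_ev_blocks (c : List Bool) :
    (ev [true, false] [false] c).count true = c.count true ∧
      (ev [true, false] [false] c).length = c.length + c.count true := by
  induction c with
  | nil => simp
  | cons d c ih => cases d <;> simp [ih.1, ih.2] <;> omega

lemma count_ev_replicate (p q : ℕ) (c : List Bool) :
    (ev (List.replicate p true) (List.replicate q false) c).count true = p * c.count true ∧
      (ev (List.replicate p true) (List.replicate q false) c).count false =
        q * c.count false := by
  induction c with
  | nil => simp
  | cons d c ih =>
    cases d <;> simp [ih.1, ih.2, List.count_replicate] <;> ring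

/-- The case of a list containing the factor `xx` cyclically. -/
lemma isRotated_of_square {b r : List Bool} (hb : IsPrimitive (true :: true :: r))
    (hbr : b ~r true :: true :: r)
    (hxy : x ++ y ≠ y ++ x) (hl : y.length ≤ x.length) (hw : ¬ IsPrimitive (ev x y b)) :
    b ~r [true, true, false] := by
  have hx : x ≠ [] := by rintro rfl; simp at hxy
  have hy : y ≠ [] := by rintro rfl; simp at hxy
  obtain ⟨u, p, hu, hp, rfl⟩ := exists_primitive_root hx
  obtain ⟨v, q, hv, hq, rfl⟩ := exists_primitive_root hy
  have huv : u ++ v ≠ v ++ u := fun h => hxy (pow_append_pow_comm h p q)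
  have hF : false ∈ true :: true :: r := mem_false_of_count hb (by simp)
  have hb' := isPrimitive_ev_replicate hp hq hb (by simp) hF
  have hw' : ¬ IsPrimitive (ev u v (ev (List.replicate p true) (List.replicate q false)
      (true :: true :: r))) := by
    rwa [ev_ev, ev_replicate_true, ev_replicate_false,
      ← isPrimitive_iff_of_isRotated (ev_isRotated hbr)]
  have hX : ∀ k : ℤ, 0 ≤ k → k < 2 * p → letterX (ev (List.replicate p true)
      (List.replicate q false) (true :: true :: r)) (0 + k) := by
    intro k h0 h1
    have e : ev (List.replicate p true) (List.replicate q false) (true :: true :: r) =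
        List.replicate (2 * p) true ++ ev (List.replicate p true) (List.replicate q false) r := by
      rw [ev_cons_true, ev_cons_true, ← List.append_assoc, two_mul, List.replicate_add]
    rw [zero_add, letterX, cyc_of_lt _ h0 (by rw [e]; simp; omega), toFun, e,
      List.getElem?_append_left (by simp; omega), List.getElem?_replicate]
    simp; omega
  have hcount := count_ev_replicate p q (true :: true :: r)
  rcases le_or_gt v.length u.length with h | h
  · have hrot := isRotated_of_primitive hb' hu hv huv h (hX 0 le_rfl (by omega))
      (by simpa using hX 1 (by omega) (by omega)) hw'
    rw [hrot.perm.count_eq, hrot.perm.count_eq] at hcount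
    simp only [List.count_cons, List.count_nil] at hcount
    simp at hcount
    obtain ⟨c1, c2⟩ := hcount
    have c3 : r.count true = 0 := by
      by_contra hc
      have : 3 ≤ r.count true + 1 + 1 := by omega
      nlinarith
    have c4 : r.count false = 1 := Nat.eq_one_of_mul_eq_one_left c2.symm
    have c5 := List.count_true_add_count_false r
    rw [c3, c4, zero_add] at c5
    obtain ⟨c, rfl⟩ := List.length_eq_one_iff.1 c5.symm
    cases c
    · exact hbr
    · simp at c3
  · exfalso
    rw [length_pow, length_pow] at hl
    have hp2 : 2 ≤ p := by
      by_contra hc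
      obtain rfl : p = 1 := by omega
      nlinarith
    have hN := ev_ne_nil hb'.1 hu.1 hv.1
    have hN' := List.length_pos_iff.2 hN
    obtain ⟨s, s0, s1, -, hs⟩ := exists_period_of_not_isPrimitive hN hw'
    have hA := isParse_cyc (x := u) (y := v) hb'.1
    refine power_cover hu.primWord hv.primWord
      (by exact_mod_cast List.length_pos_iff.2 hu.1) (by exact_mod_cast h) (r := 2 * p)
      (by omega) ?_ hA (hA.translate hs) (cutPos_ne huv hb' s0 (by omega) hs) hX
    have : v.length ≤ p * u.length := by nlinarith
    have : 2 * v.length ≤ 2 * p * u.length := by rw [mul_assoc]; omega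
    exact_mod_cast this

/-- Let `|y| ≤ |x|`. If a primitive list over `{x, y}` with at least two letters `x` has an
imprimitive concatenation, then it is a conjugate of `xxy`. -/
theorem isRotated_of_two_le_count {b : List Bool} (hb : IsPrimitive b) (hc : 2 ≤ b.count true)
    (hxy : x ++ y ≠ y ++ x) (hl : y.length ≤ x.length) (hw : ¬ IsPrimitive (ev x y b)) :
    b ~r [true, true, false] := by
  induction hN : b.length using Nat.strong_induction_on generalizing x b with
  | _ N ih =>
  by_cases hsq : ∃ i, letterX b i ∧ letterX b (i + 1)
  · obtain ⟨i, h0, h1⟩ := hsq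
    have hb' : 0 < b.length := List.length_pos_iff.2 hb.1
    have hi := Int.emod_nonneg i (b := b.length) (by omega)
    have hrot : ∀ t, cyc (b.rotate (i % b.length).toNat) t = cyc b (t + i) := by
      intro t
      rw [cyc_rotate _ _ hb.1, Int.toNat_of_nonneg hi,
        ← periodic_of_dvd (cyc_periodic b) (Dvd.intro (i / b.length) rfl) (t + _), add_assoc,
        Int.emod_add_mul_ediv]
    have hr : b ~r b.rotate (i % b.length).toNat := ⟨_, rfl⟩
    have k0 := hrot 0
    have k1 := hrot 1
    rw [zero_add, h0] at k0
    rw [add_comm, h1] at k1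
    rw [isPrimitive_iff_of_isRotated hr] at hb
    rw [hr.perm.count_eq] at hc
    generalize b.rotate (i % b.length).toNat = d at *
    match d, k0, k1 with
    | [], k0, _ => simp [cyc] at k0
    | [c], _, _ => 
      have := List.count_le_length (a := true) (l := [c])
      simp at this; omega
    | c :: c' :: r, k0, k1 =>
      rw [cyc_of_lt _ le_rfl (by simp; omega)] at k0
      rw [cyc_of_lt _ (by omega) (by simp)] at k1
      simp [toFun] at k0 k1
      subst k0 k1
      exact isRotated_of_square hb hr hxy hl hw
  · -- no `xx`: the list is a list over `xy` and `y`
    obtain ⟨p, q, hpq⟩ := List.append_of_mem (List.count_pos_iff.1 (by omega : 0 < b.count true))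
    have hr : b ~r true :: (q ++ p) := by rw [hpq]; exact List.isRotated_append
    obtain ⟨k, hk⟩ := id hr
    have hsq' : ∀ i, ¬ (letterX (true :: (q ++ p)) i ∧ letterX (true :: (q ++ p)) (i + 1)) := by
      rintro i ⟨h0, h1⟩
      rw [← hk, letterX_rotate hb.1] at h0 h1
      exact hsq ⟨i + k, h0, by rwa [add_right_comm]⟩
    have hlen := hr.perm.length_eq
    rw [isPrimitive_iff_of_isRotated hr] at hb
    rw [isPrimitive_iff_of_isRotated (ev_isRotated hr)] at hw
    rw [hr.perm.count_eq] at hc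
    have hhead : (true :: (q ++ p))[0]? = some true := rfl
    generalize true :: (q ++ p) = d at *
    have hd' : 0 < d.length := List.length_pos_iff.2 hb.1
    have hget : ∀ k (hk : k < (d ++ [true]).length), cyc d k = some (d ++ [true])[k] := by
      intro k hk
      rw [← List.getElem?_eq_getElem]
      by_cases h : k < d.length
      · rw [cyc_of_lt _ (by omega) (by omega), List.getElem?_append_left h]; rfl
      · obtain rfl : k = d.length := by simp at hk; omega
        rw [List.getElem?_append_right le_rfl, cyc, Int.emod_self, Int.toNat_zero, hhead]
        simp
    obtain ⟨c, rfl⟩ := exists_blocks d (List.isChain_iff_getElem.2 fun k hk => by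
      by_contra hcon
      push Not at hcon
      simp only [ne_eq, Bool.not_eq_false] at hcon
      refine hsq' k ⟨?_, ?_⟩
      · rw [letterX, hget k (by omega), hcon.1]
      · have := hget (k + 1) hk
        push_cast at this
        rw [letterX, this, hcon.2])
    obtain ⟨c1, c2⟩ := count_ev_blocks c
    have hcp : IsPrimitive c := by
      by_contra hcp
      obtain ⟨u, k, -, hk2, rfl⟩ := exists_root_of_not_isPrimitive (by rintro rfl; simp at hd') hcp
      rw [ev_pow] at hb
      exact not_isPrimitive_pow _ hk2 hb
    have hwc : ev x y (ev [true, false] [false] c) = ev (x ++ y) y c := by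
      rw [ev_ev]; simp
    have hxy' : (x ++ y) ++ y ≠ y ++ (x ++ y) := by
      intro h
      apply hxy
      rw [← List.append_assoc] at h
      exact List.append_cancel_right h
    have hrot := ih c.length (by omega) (x := x ++ y) hcp (by omega) hxy' (by simp)
      (by rwa [← hwc]) rfl
    refine absurd (isPrimitive_ev_two_blocks hxy) ?_
    rwa [← isPrimitive_iff_of_isRotated (ev_isRotated hrot), ← hwc]

end

/-! ### Exponents -/

section

variable {α : Type*} {x y : List α}

lemma isPrimitive_true_false : IsPrimitive [true, false] := by
  refine ⟨by simp, ?_⟩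
  rintro ⟨u, n, hu, h⟩
  match u, hu with
  | [], _ => simp [pow] at h
  | [c], _ =>
    rw [pow, List.flatten_replicate_singleton] at h
    have h1 := List.eq_of_mem_replicate (h ▸ (by simp) : true ∈ List.replicate n c)
    have h2 := List.eq_of_mem_replicate (h ▸ (by simp) : false ∈ List.replicate n c)
    simp [← h1] at h2

lemma isPrimitive_replicate_append {j k : ℕ} (hj : 1 ≤ j) (hk : 1 ≤ k) :
    IsPrimitive (List.replicate j true ++ List.replicate k false) := by
  simpa using isPrimitive_ev_replicate hj hk isPrimitive_true_false (by simp) (by simp)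

lemma ev_replicate_append (j k : ℕ) :
    ev x y (List.replicate j true ++ List.replicate k false) = pow x j ++ pow y k := by
  rw [ev_append, ev_replicate_true, ev_replicate_false]

/-- The theorem of Lyndon and Schützenberger. -/
lemma isPrimitive_pow_append_pow (hxy : x ++ y ≠ y ++ x) {j k : ℕ} (hj : 2 ≤ j) (hk : 2 ≤ k) :
    IsPrimitive (pow x j ++ pow y k) := by
  wlog hl : y.length ≤ x.length generalizing x y j k
  · rw [isPrimitive_iff_of_isRotated List.isRotated_append]
    exact this hxy.symm hk hj (by omega)
  by_contra hw
  rw [← ev_replicate_append] at hw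
  have := isRotated_of_two_le_count (isPrimitive_replicate_append (by omega) (by omega))
    (by simpa [List.count_replicate] using hj) hxy hl hw
  have := this.perm.count_eq false
  simp [List.count_replicate] at this
  omega

/-- For noncommuting words, `x y^k` is imprimitive for at most one exponent. -/
lemma isPrimitive_append_pow_of_lt (hxy : x ++ y ≠ y ++ x) {k k' : ℕ} (hk : 1 ≤ k) (hkk : k < k')
    (h : ¬ IsPrimitive (x ++ pow y k)) : IsPrimitive (x ++ pow y k') := by
  have hx : x ≠ [] := by rintro rfl; simp at hxy
  have hy : y ≠ [] := by rintro rfl; simp at hxy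
  obtain ⟨z, l, hz, hl, he⟩ := exists_root_of_not_isPrimitive (by simp [hx]) h
  obtain ⟨d, rfl⟩ : ∃ d, k' = k + d := ⟨k' - k, by omega⟩
  have hzy : z ++ y ≠ y ++ z := by
    intro hc
    have h1 := append_pow_comm hc.symm l
    rw [← he, List.append_assoc, ← append_pow_comm rfl k, ← List.append_assoc,
      ← List.append_assoc] at h1
    exact hxy (List.append_cancel_right h1).symm
  rw [pow_add', ← List.append_assoc, he]
  by_cases hd : 2 ≤ d
  · exact isPrimitive_pow_append_pow hzy hl hd
  obtain rfl : d = 1 := by omega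
  rw [pow_one', isPrimitive_iff_of_isRotated List.isRotated_append]
  by_contra hw
  obtain ⟨s, s0, s1, -, hs⟩ := exists_period_of_not_isPrimitive (by simp [hy]) hw
  have hN := cyc_periodic (y ++ pow z l)
  have F1 := occ_cyc (x := y) [] (pow z l)
  have F2 := occ_cyc (x := pow z l) y []
  have F3 := occ_cyc (x := x) y (pow y k)
  have G1 := occ_cyc (x := pow z l) [] []
  have G2 := occ_cyc (x := y) (x ++ pow y (k - 1)) []
  have hG := cyc_pow_periodic z (k := l) (by omega) hz
  have hGl := cyc_periodic (pow z l)
  have hlen := congrArg List.length he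
  have hz' : 0 < z.length := List.length_pos_iff.2 hz
  have e2 : x ++ pow y (k - 1) ++ y ++ [] = pow z l := by
    rw [← he, List.append_nil, List.append_assoc]
    congr 1
    obtain ⟨k, rfl⟩ := Nat.exists_eq_succ_of_ne_zero (show k ≠ 0 by omega)
    rw [Nat.succ_eq_add_one, Nat.add_sub_cancel, pow_add', pow_one']
  have e3 : y ++ x ++ pow y k = y ++ pow z l := by rw [← he, List.append_assoc]
  rw [e2] at G2
  rw [e3] at F3
  rw [List.append_nil] at F2
  rw [List.nil_append, List.append_nil] at G1
  rw [List.nil_append] at F1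
  have e4 : (x ++ pow y (k - 1)).length + y.length = (pow z l).length := by
    rw [← e2]; simp; omega
  simp only [List.length_append, length_pow, List.length_nil] at *
  push_cast at *
  generalize cyc (y ++ pow z l) = F at *
  generalize cyc (pow z l) = G at *
  -- as `y` is a suffix of a power of `z`, the word `y z^l` has the period `|z|`
  have hFG : ∀ t : ℤ, 0 ≤ t → t < y.length + l * z.length → F t = G (t - y.length) := by
    intro t h0 h1
    by_cases ht : t < y.length
    · have a1 := F1 t h0 ht
      have a2 := G2 t h0 ht
      rw [zero_add] at a1
      rw [a1, ← a2, ← hGl (t - y.length)]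
      congr 1
      have : (x.length + (k - 1 : ℕ) * y.length + y.length : ℤ) = l * z.length := by
        exact_mod_cast e4
      linarith
    · have a1 := F2 (t - y.length) (by omega) (by omega)
      have a2 := G1 (t - y.length) (by omega) (by omega)
      rw [zero_add] at a2
      rw [add_sub_cancel] at a1
      rw [a1, a2]
  have hlz : 2 * z.length ≤ l * z.length := Nat.mul_le_mul_right _ hl
  have hlz' : (2 * z.length : ℤ) ≤ l * z.length := by exact_mod_cast hlz
  have pz : Function.Periodic F z.length := by
    refine periodic_of_window (a := 0) (b := y.length + l * z.length) hs s0 (fun t h0 h1 => ?_)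
      (by omega)
    rw [hFG t h0 (by omega), hFG _ (by omega) h1, ← hG]
    congr 1; ring
  have pl : Function.Periodic F (l * z.length : ℤ) := periodic_of_dvd pz (dvd_mul_left _ _)
  have py : Function.Periodic F y.length := by
    have := hN.sub_period pl
    rwa [add_sub_cancel_right] at this
  have px : Function.Periodic F x.length := by
    have := pl.sub_period (periodic_of_dvd py (dvd_mul_left _ (k : ℤ)))
    have e : (x.length + k * y.length : ℤ) = l * z.length := by exact_mod_cast hlen
    rwa [← e, add_sub_cancel_right] at this
  exact hxy (comm_of_periodic px py F3 F1 (by simpa using py.neg))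

/-- Let `|y| ≤ |x|`. If `xxy` is imprimitive, then no `x y^k` is. -/
lemma isPrimitive_append_pow_of_square (hxy : x ++ y ≠ y ++ x) (hl : y.length ≤ x.length) {k : ℕ}
    (hk : 1 ≤ k) (h : ¬ IsPrimitive (x ++ x ++ y)) : IsPrimitive (x ++ pow y k) := by
  have hx : x ≠ [] := by rintro rfl; simp at hxy
  have hy : y ≠ [] := by rintro rfl; simp at hxy
  have hx' : 0 < x.length := List.length_pos_iff.2 hx
  have hy' : 0 < y.length := List.length_pos_iff.2 hy
  by_contra hw
  obtain ⟨s, s0, s1, -, hs⟩ := exists_period_of_not_isPrimitive (by simp [hx]) hw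
  obtain ⟨r, r0, r1, rd, hr⟩ := exists_period_of_not_isPrimitive (by simp [hx]) h
  have hN := cyc_periodic (x ++ pow y k)
  have hM := cyc_periodic (x ++ x ++ y)
  have G1 := occ_cyc (x := x) [] (x ++ y)
  have G2 := occ_cyc (x := x) x y
  have G3 := occ_cyc (x := y) (x ++ x) []
  have F1 := occ_cyc (x := x) [] (pow y k)
  have F2 := occ_cyc (x := y) x (pow y (k - 1))
  have F3 := occ_cyc (x := y) (x ++ pow y (k - 1)) []
  have F4 := occ_cyc (x := pow y k) x []
  obtain ⟨k, rfl⟩ : ∃ k', k = k' + 1 := ⟨k - 1, by omega⟩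
  rw [Nat.add_sub_cancel] at F2 F3
  have e2 : x ++ y ++ pow y k = x ++ pow y (k + 1) := by rw [pow_succ', List.append_assoc]
  have e3 : x ++ pow y k ++ y ++ [] = x ++ pow y (k + 1) := by
    rw [pow_add', pow_one', List.append_nil, List.append_assoc]
  rw [e2] at F2
  rw [e3] at F3
  simp only [List.nil_append, List.append_nil, ← List.append_assoc] at G1 G2 G3 F1 F4
  simp only [List.length_append, length_pow, List.length_nil] at *
  push_cast at *
  have cp := cyc_pow_periodic y (k := k + 1) (by omega) hy
  have hFy : Per (cyc (x ++ pow y (k + 1))) y.length x.length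
      (x.length + (k + 1) * y.length) := by
    intro t h0 h1
    have a1 := F4 (t - x.length) (by omega) (by omega)
    have a2 := F4 (t + y.length - x.length) (by omega) (by omega)
    rw [add_sub_cancel] at a1 a2
    rw [a1, a2, ← cyc_of_lt _ (by omega) (by rw [length_pow]; push_cast; omega),
      ← cyc_of_lt _ (by omega) (by rw [length_pow]; push_cast; omega), ← cp]
    congr 1; ring
  generalize cyc (x ++ pow y (k + 1)) = F at *
  generalize cyc (x ++ x ++ y) = G at *
  generalize hn : (x.length : ℤ) = n at *
  generalize hm : (y.length : ℤ) = m at *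
  have hGn : Per G n 0 (2 * n) := by
    have := G1.per G2
    simpa [two_mul] using this
  have hrn : n < r := by
    by_contra hrn
    have pn := periodic_of_window hr r0 hGn (by omega)
    have pm : Function.Periodic G m := by
      have := (hM.sub_period pn).sub_period pn
      rwa [show n + n + m - n - n = m by ring] at this
    subst hn hm
    refine hxy (comm_of_periodic pn pm G1 G3 ?_)
    simpa using pn.add_period pn
  have hr2 : n + n + m = 2 * r := by
    obtain ⟨q, hq⟩ := rd
    have : 1 < q := by nlinarith
    have : q < 3 := by nlinarith
    obtain rfl : q = 2 := by omega
    linarith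
  obtain ⟨d, rfl⟩ : ∃ d, r = n + d := ⟨r - n, by ring⟩
  obtain rfl : m = 2 * d := by linarith
  -- the last half of `y`, followed by `x` and the first half of `y`, has the period `d`
  have G4 : Occ G (toFun x) n (-d) := by
    intro t h0 h1
    rw [← hr, ← G2 t h0 h1]; congr 1; ring
  have G5 : Occ G (toFun x) n (n + d) := by
    intro t h0 h1
    have := G1 t h0 h1
    rw [zero_add] at this
    rw [← this, ← hr t]; congr 1; ring
  have G6 : Occ G (toFun y) (2 * d) (-(2 * d)) := by
    intro t h0 h1
    rw [← hM, ← G3 t h0 h1]; congr 1; ring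
  have F5 : Occ F (toFun y) (2 * d) (-(2 * d)) := by
    intro t h0 h1
    rw [← hN, ← F3 t h0 h1]; congr 1; ring
  have q1 : Per G d (-d) n := by
    have := G4.per G1
    simpa using this
  have q2 : Per G d n (2 * n + d) := by
    have := G2.per G5
    rwa [add_sub_cancel_left, add_right_comm, ← two_mul] at this
  have f1 : ∀ t, -(2 * d) ≤ t → t < n → F t = G t := by
    intro t h0 h1
    by_cases ht : t < 0
    · have a1 := F5 (t + 2 * d) (by omega) (by omega)
      have a2 := G6 (t + 2 * d) (by omega) (by omega)
      rw [show -(2 * d) + (t + 2 * d) = t by ring] at a1 a2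
      rw [a1, a2]
    · have a1 := F1 t (by omega) h1
      have a2 := G1 t (by omega) h1
      rw [zero_add] at a1 a2
      rw [a1, a2]
  have f2 : ∀ t, 0 ≤ t → t < n + 2 * d → F t = G (t + n) := by
    intro t h0 h1
    by_cases ht : t < n
    · have a1 := F1 t (by omega) ht
      have a2 := G2 t (by omega) ht
      rw [zero_add] at a1
      rw [a1, add_comm t, a2]
    · have a1 := F2 (t - n) (by omega) (by omega)
      have a2 := G3 (t - n) (by omega) (by omega)
      rw [show n + (t - n) = t by ring] at a1
      rw [show n + n + (t - n) = t + n by ring] at a2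
      rw [a1, a2]
  have q3 : Per F d (-d) (n + d) := by
    intro t h0 h1
    by_cases ht : t < 0
    · rw [f1 t (by omega) (by omega), f1 (t + d) (by omega) (by omega)]
      exact q1 t h0 (by omega)
    · rw [f2 t (by omega) (by omega), f2 (t + d) (by omega) (by omega), add_right_comm]
      exact q2 _ (by omega) (by omega)
  have hkd : 0 ≤ (k : ℤ) * (2 * d) := by
    have : 0 < d := by omega
    positivity
  have hNk' : ((k : ℤ) + 1) * (2 * d) = k * (2 * d) + 2 * d := by ring
  have pd : Function.Periodic F d := by
    by_cases hsn : s < n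
    · exact periodic_of_window hs s0 q3 (by omega)
    · have F6 : Occ F (toFun x) n s := by
        intro t h0 h1
        have := F1 t h0 h1
        rw [zero_add] at this
        rw [← this, ← hs t]; congr 1; ring
      have q4 : Per F d s (s + n) := by
        intro t h0 h1
        have a1 := F6 (t - s) (by omega) (by omega)
        have a2 := F6 (t + d - s) (by omega) (by omega)
        have a3 := F1 (t - s) (by omega) (by omega)
        have a4 := F1 (t + d - s) (by omega) (by omega)
        rw [add_sub_cancel] at a1 a2
        rw [a1, a2, ← a3, ← a4]
        have := q3 (t - s) (by omega) (by omega)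
        rw [zero_add, zero_add, this]; congr 1; ring
      have q5 := hFy.extend q4 (by omega) (by omega) (by omega) (by omega) (by omega)
        (dvd_mul_left d 2)
      refine periodic_of_window (a := 0) (b := n + (k + 1) * (2 * d)) hs s0 (fun t h0 h1 => ?_)
        (by omega)
      by_cases ht : t < n
      · exact q3 t (by omega) (by omega)
      · exact q5 t (by omega) h1
  have pm := periodic_of_dvd pd (dvd_mul_left d 2)
  have pn : Function.Periodic F n := by
    have := hN.sub_period (periodic_of_dvd pm (dvd_mul_left (2 * d) (k + 1 : ℤ)))
    rwa [add_sub_cancel_right] at this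
  subst hn
  rw [← hm] at pm F2
  exact hxy (comm_of_periodic pn pm F1 F2 (by simpa using pn))

/-- Let `|y| ≤ |x|`. If `xxy` is imprimitive, then `x` is primitive. -/
lemma isPrimitive_left_of_square (hxy : x ++ y ≠ y ++ x) (hl : y.length ≤ x.length)
    (h : ¬ IsPrimitive (x ++ x ++ y)) : IsPrimitive x := by
  have hx : x ≠ [] := by rintro rfl; simp at hxy
  by_contra hp
  obtain ⟨r, r0, r1, rd, hr⟩ := exists_period_of_not_isPrimitive (by simp [hx]) h
  obtain ⟨u, i, hu, hi, hxu⟩ := exists_root_of_not_isPrimitive hx hp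
  have hM := cyc_periodic (x ++ x ++ y)
  have G1 := occ_cyc (x := x) [] (x ++ y)
  have G3 := occ_cyc (x := y) (x ++ x) []
  have G4 := occ_cyc (x := x ++ x) [] y
  have hxx : x ++ x = pow u (i + i) := by rw [pow_add', ← hxu]
  have cp := cyc_pow_periodic u (k := i + i) (by omega) hu
  rw [← hxx] at cp
  have hlen := congrArg List.length hxu
  rw [length_pow] at hlen
  have h2 : 2 * u.length ≤ i * u.length := Nat.mul_le_mul_right _ hi
  have hdvd : (u.length : ℤ) ∣ x.length := ⟨i, by rw [hlen]; push_cast; ring⟩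
  simp only [List.nil_append, List.append_nil, ← List.append_assoc] at G1 G3 G4
  simp only [List.length_append, List.length_nil] at *
  push_cast at *
  generalize cyc (x ++ x ++ y) = G at *
  have pu : Function.Periodic G u.length := by
    refine periodic_of_window (a := 0) (b := x.length + x.length) hr r0 (fun t h0 h1 => ?_)
      (by omega)
    have a1 := G4 t h0 (by omega)
    have a2 := G4 (t + u.length) (by omega) (by omega)
    rw [zero_add] at a1 a2
    rw [a1, a2, ← cyc_of_lt _ h0 (by simp; omega),
      ← cyc_of_lt _ (by omega) (by simp; omega), cp]
  have pn := periodic_of_dvd pu hdvd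
  have pm : Function.Periodic G y.length := by
    have := (hM.sub_period pn).sub_period pn
    rwa [show (x.length + x.length + y.length - x.length - x.length : ℤ) = y.length by ring] at this
  refine hxy (comm_of_periodic pn pm G1 G3 ?_)
  simpa using pn.add_period pn

end

/-! ### The classification -/

section

variable {α : Type*} {x y : List α}

/-- Let `|y| ≤ |x|`. A primitive list of length at least two with an imprimitive concatenation is a
conjugate of `xxy` or of some `x y^k`. -/
lemma isRotated_or_isRotated (hxy : x ++ y ≠ y ++ x) (hl : y.length ≤ x.length) {b : List Bool}
    (hb : IsPrimitive b) (hb2 : 2 ≤ b.length) (hw : ¬ IsPrimitive (ev x y b)) :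
    b ~r List.replicate 2 true ++ List.replicate 1 false ∨
      ∃ k, 1 ≤ k ∧ b ~r List.replicate 1 true ++ List.replicate k false := by
  rcases le_or_gt 2 (b.count true) with hc | hc
  · exact Or.inl (isRotated_of_two_le_count hb hc hxy hl hw)
  · right
    have hcc := List.count_true_add_count_false b
    have h1 : 0 < b.count true := by
      by_contra h0
      have h0 : b.count true = 0 := by omega
      have : b = pow [false] b.length := by
        rw [pow, List.flatten_replicate_singleton]
        refine List.eq_replicate_of_mem fun c hcb => ?_
        cases c
        · rfl
        · exact absurd hcb (List.count_eq_zero.1 h0)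
      rw [this] at hb
      exact not_isPrimitive_pow _ hb2 hb
    obtain ⟨p, q, rfl⟩ := List.append_of_mem (List.count_pos_iff.1 h1)
    have hr : p ++ true :: q ~r true :: (q ++ p) := List.isRotated_append
    have h2 := hr.perm.count_eq true
    have h3 := hr.perm.length_eq
    rw [List.count_cons_self] at h2
    refine ⟨(q ++ p).length, by simp only [List.length_cons] at h3; omega, ?_⟩
    have : q ++ p = List.replicate (q ++ p).length false := by
      refine List.eq_replicate_of_mem fun c hcb => ?_
      cases c
      · rfl
      · exact absurd hcb (List.count_eq_zero.1 (by omega))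
    rw [← this]
    exact hr

/-- The two-letter form of the classification: the exponents, and the primitivity of `x` and
`y`. -/
lemma exists_exponents (hxy : x ++ y ≠ y ++ x) (hl : y.length ≤ x.length)
    (h : ∃ b, IsPrimitive b ∧ 2 ≤ b.length ∧ ¬ IsPrimitive (ev x y b)) :
    ∃ j k : ℕ, 1 ≤ j ∧ 1 ≤ k ∧ (j = 1 ∨ k = 1) ∧
      (∀ b : List Bool, 2 ≤ b.length → (IsPrimitive b ∧ ¬ IsPrimitive (ev x y b) ↔
        b ~r List.replicate j true ++ List.replicate k false)) ∧
      (2 ≤ j → j = 2 ∧ k = 1 ∧ IsPrimitive x ∧ IsPrimitive y) ∧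
      (2 ≤ k → j = 1 ∧ IsPrimitive x) := by
  have hx : x ≠ [] := by rintro rfl; simp at hxy
  have hy : y ≠ [] := by rintro rfl; simp at hxy
  have himp : ∀ {b : List Bool} {j k : ℕ}, b ~r List.replicate j true ++ List.replicate k false →
      (IsPrimitive (ev x y b) ↔ IsPrimitive (pow x j ++ pow y k)) := by
    intro b j k hr
    rw [isPrimitive_iff_of_isRotated (ev_isRotated hr), ev_replicate_append]
  have hback : ∀ {j k : ℕ}, 1 ≤ j → 1 ≤ k → ¬ IsPrimitive (pow x j ++ pow y k) →
      ∀ b, b ~r List.replicate j true ++ List.replicate k false →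
        IsPrimitive b ∧ ¬ IsPrimitive (ev x y b) := by
    intro j k hj hk hw b hr
    rw [himp hr, isPrimitive_iff_of_isRotated hr]
    exact ⟨isPrimitive_replicate_append hj hk, hw⟩
  have e2 : pow x 2 ++ pow y 1 = x ++ x ++ y := by simp [pow_succ', pow_zero']
  obtain ⟨b₀, hb₀, hb₀2, hw₀⟩ := h
  rcases isRotated_or_isRotated hxy hl hb₀ hb₀2 hw₀ with hr | ⟨k, hk, hr⟩
  · rw [himp hr] at hw₀
    have hsq := hw₀
    rw [e2] at hsq
    refine ⟨2, 1, by omega, le_rfl, Or.inr rfl, fun b hb2 => ⟨fun ⟨hb, hw⟩ => ?_,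
      hback (by omega) le_rfl hw₀ b⟩, fun _ =>
      ⟨rfl, rfl, isPrimitive_left_of_square hxy hl hsq, ?_⟩,
      fun h => by omega⟩
    · rcases isRotated_or_isRotated hxy hl hb hb2 hw with h | ⟨k, hk, h⟩
      · exact h
      · rw [himp h, pow_one'] at hw
        exact absurd (isPrimitive_append_pow_of_square hxy hl hk hsq) hw
    · by_contra hp
      obtain ⟨v, i, -, hi, rfl⟩ := exists_root_of_not_isPrimitive hy hp
      rw [pow_one'] at hw₀
      exact hw₀ (isPrimitive_pow_append_pow
        (fun h => hxy (append_pow_comm h i)) le_rfl hi)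
  · rw [himp hr] at hw₀
    have hk' := hw₀
    rw [pow_one'] at hk'
    refine ⟨1, k, le_rfl, hk, Or.inl rfl, fun b hb2 => ⟨fun ⟨hb, hw⟩ => ?_,
      hback le_rfl hk hw₀ b⟩, fun h => by omega, fun hk2 => ⟨rfl, ?_⟩⟩
    · rcases isRotated_or_isRotated hxy hl hb hb2 hw with h | ⟨k', hk'1, h⟩
      · rw [himp h, e2] at hw
        exact absurd (isPrimitive_append_pow_of_square hxy hl hk hw) hk'
      · rw [himp h, pow_one'] at hw
        rcases lt_trichotomy k k' with hlt | rfl | hlt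
        · exact absurd (isPrimitive_append_pow_of_lt hxy hk hlt hk') hw
        · exact h
        · exact absurd (isPrimitive_append_pow_of_lt hxy hk'1 hlt hw) hk'
    · by_contra hp
      obtain ⟨u, i, -, hi, rfl⟩ := exists_root_of_not_isPrimitive hx hp
      exact hk' (isPrimitive_pow_append_pow
        (fun h => hxy (append_pow_comm h.symm i).symm) hi hk2)

/-- The list over `{x, y}` that is described by a word over a two-letter alphabet. -/
def spell (x y : List α) (b : List Bool) : List (List α) := b.map fun c => bif c then x else y

lemma flatten_spell (b : List Bool) : (spell x y b).flatten = ev x y b := by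
  rw [spell, ev, List.flatMap]

lemma exists_spell {w : List (List α)} (hw : ∀ u ∈ w, u ∈ ({x, y} : Set (List α))) :
    ∃ b, w = spell x y b := by
  induction w with
  | nil => exact ⟨[], rfl⟩
  | cons u w ih =>
    obtain ⟨b, rfl⟩ := ih fun v hv => hw v (List.mem_cons_of_mem _ hv)
    rcases hw u List.mem_cons_self with rfl | rfl
    · exact ⟨true :: b, rfl⟩
    · exact ⟨false :: b, rfl⟩

lemma spell_injective (hxy : x ≠ y) : Function.Injective (spell x y) := by
  refine List.map_injective_iff.2 ?_
  rintro (_ | _) (_ | _) h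
  · rfl
  · exact absurd h.symm hxy
  · exact absurd h hxy
  · rfl

lemma spell_eq_ev (b : List Bool) : spell x y b = ev [x] [y] b := by
  induction b with
  | nil => rfl
  | cons c b ih =>
    rw [spell] at ih
    cases c <;> simp [spell, ih]

/-- As a word whose letters are words, a list over `{x, y}` is primitive if and only if the
underlying word over the two-letter alphabet is. -/
lemma isPrimitive_spell (hxy : x ≠ y) (b : List Bool) :
    IsPrimitive (spell x y b) ↔ IsPrimitive b := by
  by_cases hb0 : b = []
  · subst hb0
    exact ⟨fun h => absurd rfl h.1, fun h => absurd rfl h.1⟩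
  constructor
  · intro h
    by_contra hb
    obtain ⟨c, k, -, hk, rfl⟩ := exists_root_of_not_isPrimitive hb0 hb
    rw [spell_eq_ev, ev_pow] at h
    exact not_isPrimitive_pow _ hk h
  · intro h
    by_contra hb
    obtain ⟨v, k, -, hk, he⟩ := exists_root_of_not_isPrimitive
      (by simpa [spell] using hb0) hb
    have hv : ∀ u ∈ v, u ∈ ({x, y} : Set (List α)) := by
      intro u hu
      have : u ∈ spell x y b := by
        obtain ⟨k, rfl⟩ := Nat.exists_eq_succ_of_ne_zero (show k ≠ 0 by omega)
        rw [he, Nat.succ_eq_add_one, pow_succ']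
        exact List.mem_append_left _ hu
      rw [spell, List.mem_map] at this
      obtain ⟨c, -, rfl⟩ := this
      cases c <;> simp
    obtain ⟨c, rfl⟩ := exists_spell hv
    rw [spell_eq_ev c, ← ev_pow, ← spell_eq_ev] at he
    rw [spell_injective hxy he] at h
    exact not_isPrimitive_pow _ hk h

lemma spell_isRotated (hxy : x ≠ y) {b c : List Bool} :
    spell x y b ~r spell x y c ↔ b ~r c := by
  constructor
  · rintro ⟨k, hk⟩
    refine ⟨k, spell_injective hxy ?_⟩
    rw [← hk, spell, List.map_rotate]; rfl
  · rintro ⟨k, rfl⟩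
    exact ⟨k, by rw [spell, spell, List.map_rotate]⟩

lemma pow_singleton_append (j k : ℕ) :
    pow [x] j ++ pow [y] k = spell x y (List.replicate j true ++ List.replicate k false) := by
  rw [spell_eq_ev, ev_replicate_append]

lemma witnessesAreConjugatesOf_iff (hxy : x ≠ y) (j k : ℕ) :
    WitnessesAreConjugatesOf x y j k ↔
      ∀ b : List Bool, 2 ≤ b.length → (IsPrimitive b ∧ ¬ IsPrimitive (ev x y b) ↔
        b ~r List.replicate j true ++ List.replicate k false) := by
  have key : ∀ b, (IsPrimitiveWithImprimitiveConcat (spell x y b) ↔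
      List.IsRotated (spell x y b) (pow [x] j ++ pow [y] k)) ↔
      (IsPrimitive b ∧ ¬ IsPrimitive (ev x y b) ↔
        b ~r List.replicate j true ++ List.replicate k false) := by
    intro b
    rw [IsPrimitiveWithImprimitiveConcat, isPrimitive_spell hxy, flatten_spell,
      pow_singleton_append, spell_isRotated hxy]
  constructor
  · intro h b hb
    refine (key b).1 (h _ (fun u hu => ?_) (by simpa [spell] using hb))
    rw [spell, List.mem_map] at hu
    obtain ⟨c, -, rfl⟩ := hu
    cases c <;> simp
  · intro h w hw hw2
    obtain ⟨b, rfl⟩ := exists_spell hw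
    exact (key b).2 (h b (by simpa [spell] using hw2))

lemma WitnessesAreConjugatesOf.swap {j k : ℕ} (h : WitnessesAreConjugatesOf x y j k) :
    WitnessesAreConjugatesOf y x k j := by
  intro w hw hw2
  rw [Set.pair_comm] at hw
  rw [h w hw hw2]
  exact ⟨fun h => h.trans List.isRotated_append, fun h => h.trans List.isRotated_append⟩

/-- A list of length at least two over a one-element set is a proper power. -/
lemma ne_of_not_isPrimitivityPreserving
    (hpres : ¬ IsPrimitivityPreserving ({x, y} : Set (List α))) : x ≠ y := by
  rintro rfl
  refine hpres ?_
  rintro ⟨w, hw, hw2, hw3, -⟩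
  have : w = pow [x] w.length := by
    rw [pow, List.flatten_replicate_singleton]
    exact List.eq_replicate_of_mem fun u hu => by simpa using hw u hu
  rw [this] at hw3
  exact not_isPrimitive_pow _ hw2 hw3

lemma noncomm_of_uniquelyDecodable
    (hcode : InformationTheory.UniquelyDecodable ({x, y} : Set (List α))) (hne : x ≠ y) :
    x ++ y ≠ y ++ x := by
  intro h
  have := hcode [x, y] [y, x] (by simp) (by simp) (by simpa using h)
  simp at this
  exact hne this.1

/-- The exponents are determined by the witnesses. -/
lemma WitnessesAreConjugatesOf.unique
    (hpres : ¬ IsPrimitivityPreserving ({x, y} : Set (List α))) {j k j' k' : ℕ}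
    (h : WitnessesAreConjugatesOf x y j k) (h' : WitnessesAreConjugatesOf x y j' k') :
    j' = j ∧ k' = k := by
  have hne := ne_of_not_isPrimitivityPreserving hpres
  rw [IsPrimitivityPreserving, not_not] at hpres
  obtain ⟨w, hw, hw2, hw3⟩ := hpres
  have h1 := (h w hw hw2).1 hw3
  have h2 := (h' w hw hw2).1 hw3
  have h3 := h2.symm.trans h1
  rw [pow_singleton_append, pow_singleton_append, spell_isRotated hne] at h3
  have c1 := h3.perm.count_eq true
  have c2 := h3.perm.count_eq false
  simp [List.count_replicate] at c1 c2
  exact ⟨c1, c2⟩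

lemma exists_witnessesAreConjugatesOf
    (hcode : InformationTheory.UniquelyDecodable ({x, y} : Set (List α)))
    (hpres : ¬ IsPrimitivityPreserving ({x, y} : Set (List α))) (hl : y.length ≤ x.length) :
    ∃ j k : ℕ, (1 ≤ j ∧ 1 ≤ k ∧ (j = 1 ∨ k = 1) ∧ WitnessesAreConjugatesOf x y j k) ∧
      (2 ≤ j → j = 2 ∧ k = 1 ∧ IsPrimitive x ∧ IsPrimitive y) ∧
      (2 ≤ k → j = 1 ∧ IsPrimitive x) := by
  have hne := ne_of_not_isPrimitivityPreserving hpres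
  have hxy := noncomm_of_uniquelyDecodable hcode hne
  rw [IsPrimitivityPreserving, not_not] at hpres
  obtain ⟨w, hw, hw2, hw3, hw4⟩ := hpres
  obtain ⟨b, rfl⟩ := exists_spell hw
  rw [isPrimitive_spell hne] at hw3
  rw [flatten_spell] at hw4
  obtain ⟨j, k, hj, hk, hjk, hjk', h2, h3⟩ := exists_exponents hxy hl
    ⟨b, hw3, by simpa [spell] using hw2, hw4⟩
  exact ⟨j, k, ⟨hj, hk, hjk, (witnessesAreConjugatesOf_iff hne j k).2 hjk'⟩, h2, h3⟩

end

end Words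

theorem theorem1 {α : Type*} (x y : List α)
    (hcode : InformationTheory.UniquelyDecodable ({x, y} : Set (List α)))
    (hpres : ¬ Words.IsPrimitivityPreserving ({x, y} : Set (List α))) :
    ∃ j k : ℕ,
      (1 ≤ j ∧ 1 ≤ k ∧ (j = 1 ∨ k = 1) ∧ Words.WitnessesAreConjugatesOf x y j k) ∧
      (∀ j' k' : ℕ, 1 ≤ j' → 1 ≤ k' → Words.WitnessesAreConjugatesOf x y j' k' →
        j' = j ∧ k' = k) ∧
      (y.length ≤ x.length →
        (2 ≤ j → j = 2 ∧ k = 1 ∧ Words.IsPrimitive x ∧ Words.IsPrimitive y) ∧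
        (2 ≤ k → j = 1 ∧ Words.IsPrimitive x)) := by
  rcases le_or_gt y.length x.length with hl | hl
  · obtain ⟨j, k, h, h'⟩ := Words.exists_witnessesAreConjugatesOf hcode hpres hl
    exact ⟨j, k, h, fun j' k' _ _ hw => h.2.2.2.unique hpres hw, fun _ => h'⟩
  · obtain ⟨k, j, ⟨hk, hj, hjk, h⟩, -⟩ := Words.exists_witnessesAreConjugatesOf
      (Set.pair_comm x y ▸ hcode) (Set.pair_comm x y ▸ hpres) hl.le
    exact ⟨j, k, ⟨hj, hk, hjk.symm, h.swap⟩, fun j' k' _ _ hw => h.swap.unique hpres hw,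
      fun h' => absurd h' (by omega)⟩
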